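/- Let $(W,S)$ be a Coxeter system of finite rank $n$, with $S=\{s_1,\dots,s_n\}$ and Coxeter matrix $M=(m_{ij})_{1\le i,j\le n}$, so that $m_{ii}=1$, $m_{ij}=m_{ji}\in\{2,3,\dots\}\cup\{\infty\}$ for $i\neq j$, and $$W=\langle s_1,\dots,s_n \mid s_i^2=1,\ (s_is_j)^{m_{ij}}=1 \text{ for all } i\ne j \text{ with } m_{ij}<\infty\rangle .$$ Let $R=\{gsg^{-1} : g\in W,\ s\in S\}$ be the set of reflections. For $v\in W$ let the reflection length $l_R(v)$ be the least $k\ge 0$ such that $v$ is a product of $k$ elements of $R$ (the identity has reflection length $0$). Let $w$ be a Coxeter element, that is, $w=s_{\sigma(1)}s_{\sigma(2)}\cdots s_{\sigma(n)}$ for some permutation $\sigma$ of $\{1,\dots,n\}$. Suppose that either (i) $n=3$ and $m_{ij}\ge 5$ for all $i\ne j$, or (ii) $n\ge 4$ and $m_{ij}\ge 3$ for all $i\neq j$. Then $$\lim_{\lambda\to\infty} l_R(w^\lambda)=\infty .$$ -/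

import Mathlib

/-- The length function of a group `G` with respect to a generating set `Y`: the least `k` such
that `g` is a product of `k` elements of `Y ∪ Y⁻¹`. -/
noncomputable def lengthWithRespectTo {G : Type*} [Group G] (Y : Set G) (g : G) : ℕ :=
  sInf {k : ℕ | ∃ l : List G, (∀ y ∈ l, y ∈ Y ∨ y⁻¹ ∈ Y) ∧ l.length = k ∧ l.prod = g}

/-- The label `m i j ∈ ℕ ∪ {∞}` of a Coxeter matrix. Mathlib encodes the label `∞` as the
matrix entry `0`; here it is the top element of `ℕ∞`. -/
def CoxeterMatrix.label {B : Type*} (M : CoxeterMatrix B) (i j : B) : ℕ∞ :=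
  if M i j = 0 then ⊤ else (M i j : ℕ∞)

namespace CoxeterSystem

/-- The set `R` of reflections, that is, of all conjugates of the standard generators. -/
def reflections {B W : Type*} [Group W] {M : CoxeterMatrix B} (cs : CoxeterSystem M W) : Set W :=
  {t : W | cs.IsReflection t}

/-- The reflection length `l_R`. -/
noncomputable def reflectionLength {B W : Type*} [Group W] {M : CoxeterMatrix B}
    (cs : CoxeterSystem M W) (w : W) : ℕ :=
  lengthWithRespectTo cs.reflections w

/-- A Coxeter element is a product of all standard generators, each taken exactly once, in some
order. -/
def IsCoxeterElement {B W : Type*} [Group W] {M : CoxeterMatrix B} (cs : CoxeterSystem M W)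
    (w : W) : Prop :=
  ∃ l : List B, l.Nodup ∧ (∀ i : B, i ∈ l) ∧ w = (l.map cs.simple).prod

/-- The reflections generate the group, so the minimum defining the reflection length is taken
over a non-empty set and is attained. -/
theorem exists_reflection_factorization {B W : Type*} [Group W] {M : CoxeterMatrix B}
    (cs : CoxeterSystem M W) (w : W) :
    ∃ l : List W, (∀ t ∈ l, cs.IsReflection t) ∧ l.length = cs.reflectionLength w ∧
      l.prod = w := by
  have hne : {k : ℕ | ∃ l : List W, (∀ y ∈ l, y ∈ cs.reflections ∨ y⁻¹ ∈ cs.reflections) ∧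
      l.length = k ∧ l.prod = w}.Nonempty := by
    obtain ⟨v, hv⟩ := cs.wordProd_surjective w
    refine ⟨_, v.map cs.simple, ?_, rfl, hv⟩
    intro y hy
    obtain ⟨i, -, rfl⟩ := List.mem_map.1 hy
    exact Or.inl (cs.isReflection_simple i)
  obtain ⟨l, h1, h2, h3⟩ := Nat.sInf_mem hne
  refine ⟨l, fun t ht => ?_, h2, h3⟩
  rcases h1 t ht with h | h
  · exact h
  · have h' : cs.IsReflection t⁻¹ := h
    have h2 := h'.isReflection_inv
    rwa [inv_inv] at h2

end CoxeterSystem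

/-! Replacing every infinite label by 5 gives a quotient in which reflections become involutions and
`w` becomes a Coxeter element. So it suffices to show, for finite labels at least three, that a
factorization of `w ^ k` into involutions needs a number of factors growing linearly in `k`.

The periodic word `w w w ⋯` traces a geodesic gallery, the axis of `w`: each of its walls is crossed
once and never recrossed (`axisRoot_nonpos`, `axisRoot_nonneg`). Take as pattern the half-spaces
beyond the first `L` walls of the axis. `CountingPattern.height x y` is the maximal number of nested
translates of the pattern separating `x` from `y`, minus the same number from `y` to `x`. It is
left-invariant and antisymmetric, hence zero on `(1, t)` for an involution `t`, and it is additive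
up to an error 9; so a product of `r` involutions has height at most `9 r` in absolute value. But `w
^ k` crosses at least `k / L` nested translates forwards and none backwards.

Three facts about the axis make this work: walls at distance at least two along it are nested
(`axisRoot_nested`); no wall crosses all walls of a long segment (`not_forall_abs_cosForm_lt_one`),
which gives the bounded error; and no translate of a long segment runs backwards along the axis
(`not_axis_reversed`). They are proved in the geometric representation, where every root is positive
or negative, and where two walls whose roots have form at least 1 in absolute value do not cross
(`not_separating_of_cosForm_le`). -/

/-! ### The geometric representation of a Coxeter group with labels at least three -/

namespace CoxeterMatrix

open Real

variable {B : Type*}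

/-- All labels of distinct generators are finite and at least three. -/
class IsLarge (M : CoxeterMatrix B) : Prop where
  three_le : ∀ ⦃i j : B⦄, i ≠ j → 3 ≤ M i j

theorem ne_zero_of_isLarge (M : CoxeterMatrix B) [M.IsLarge] (i j : B) : M i j ≠ 0 := by
  rcases eq_or_ne i j with rfl | h
  · simp
  · have := IsLarge.three_le (M := M) h
    omega

/-- The cosine `cos (π / m i j)`. -/
noncomputable def cosine (M : CoxeterMatrix B) (i j : B) : ℝ := Real.cos (π / M i j)

theorem cosine_self (M : CoxeterMatrix B) (i : B) : M.cosine i i = -1 := by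
  simp [cosine]

theorem cosine_comm (M : CoxeterMatrix B) (i j : B) : M.cosine i j = M.cosine j i := by
  rw [cosine, M.symmetric, cosine]

theorem cos_pi_div_le_cosine (M : CoxeterMatrix B) {i j : B} {k : ℕ} (hk : 1 ≤ k)
    (h : k ≤ M i j) : Real.cos (π / k) ≤ M.cosine i j := by
  have h1 : (1 : ℝ) ≤ k := by exact_mod_cast hk
  have h2 : (k : ℝ) ≤ M i j := by exact_mod_cast h
  apply Real.cos_le_cos_of_nonneg_of_le_pi
  · positivity
  · exact div_le_self pi_pos.le h1
  · exact div_le_div_of_nonneg_left pi_pos.le (by linarith) h2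

theorem half_le_cosine (M : CoxeterMatrix B) [M.IsLarge] {i j : B} (h : i ≠ j) :
    1 / 2 ≤ M.cosine i j := by
  have := M.cos_pi_div_le_cosine (k := 3) (by norm_num) (IsLarge.three_le (M := M) h)
  rw [← Real.cos_pi_div_three]
  exact_mod_cast this

theorem neg_one_le_cosine (M : CoxeterMatrix B) (i j : B) : -1 ≤ M.cosine i j :=
  Real.neg_one_le_cos _

variable [Fintype B] [DecidableEq B]

/-- The canonical bilinear form, with Gram matrix `-cos (π / m i j)`. -/
noncomputable def cosForm (M : CoxeterMatrix B) : LinearMap.BilinForm ℝ (B → ℝ) :=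
  Matrix.toBilin' (Matrix.of fun i j => -M.cosine i j)

theorem cosForm_apply (M : CoxeterMatrix B) (u v : B → ℝ) :
    M.cosForm u v = ∑ i, ∑ j, u i * -M.cosine i j * v j := by
  simp [cosForm, Matrix.toBilin'_apply]

theorem cosForm_comm (M : CoxeterMatrix B) (u v : B → ℝ) : M.cosForm u v = M.cosForm v u := by
  rw [cosForm_apply, cosForm_apply, Finset.sum_comm]
  refine Finset.sum_congr rfl fun i _ => Finset.sum_congr rfl fun j _ => ?_
  rw [M.cosine_comm]
  ring

theorem cosForm_single (M : CoxeterMatrix B) (i j : B) :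
    M.cosForm (Pi.single i 1) (Pi.single j 1) = -M.cosine i j := by
  simp [cosForm]

theorem cosForm_single_self (M : CoxeterMatrix B) (i : B) :
    M.cosForm (Pi.single i 1) (Pi.single i 1) = 1 := by
  rw [cosForm_single, cosine_self, neg_neg]

theorem cosForm_single_left (M : CoxeterMatrix B) (i : B) (v : B → ℝ) :
    M.cosForm (Pi.single i 1) v = v i - ∑ j ∈ Finset.univ.erase i, M.cosine i j * v j := by
  rw [cosForm_apply, Finset.sum_eq_single i (fun j _ hj => by simp [hj])
    (by simp), ← Finset.add_sum_erase _ _ (Finset.mem_univ i), cosine_self]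
  simp [sub_eq_add_neg]

/-- The linear functional `v ↦ 2 ⟨α i, v⟩`. -/
noncomputable def coroot (M : CoxeterMatrix B) (i : B) : Module.Dual ℝ (B → ℝ) :=
  (2 : ℝ) • M.cosForm (Pi.single i 1)

theorem coroot_apply (M : CoxeterMatrix B) (i : B) (v : B → ℝ) :
    M.coroot i v = 2 * M.cosForm (Pi.single i 1) v := by
  simp [coroot]

theorem coroot_single_self (M : CoxeterMatrix B) (i : B) : M.coroot i (Pi.single i 1) = 2 := by
  rw [coroot_apply, cosForm_single_self, mul_one]

/-- The reflection in the simple root `α i`. -/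
noncomputable def simpleReflection (M : CoxeterMatrix B) (i : B) : (B → ℝ) ≃ₗ[ℝ] (B → ℝ) :=
  Module.reflection (M.coroot_single_self i)

theorem simpleReflection_apply (M : CoxeterMatrix B) (i : B) (v : B → ℝ) :
    M.simpleReflection i v = v - (2 * M.cosForm (Pi.single i 1) v) • Pi.single i 1 := by
  rw [simpleReflection, Module.reflection_apply, coroot_apply]

/-- A power of a product of two reflections has coefficients given by Chebyshev values `S` at `2 cos
θ`, with `θ = 2π / m`, that is by `sin ((n + 1) θ) / sin θ`. At the exponent `m` the relevant value
is a multiple of `sin π` when `m` is even; when `m` is odd two neighbouring values cancel because `m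
θ = 2π`. Labels at least three ensure `sin θ ≠ 0`. -/
theorem isLiftable_simpleReflection (M : CoxeterMatrix B) [M.IsLarge] :
    M.IsLiftable M.simpleReflection := by
  intro i j
  rcases eq_or_ne i j with rfl | hij
  · rw [M.diagonal, pow_one]
    ext1 v
    simpa [simpleReflection] using Module.involutive_reflection (M.coroot_single_self i) v
  have h3 := IsLarge.three_le (M := M) hij
  have h3' : (3 : ℝ) ≤ M i j := by exact_mod_cast h3
  set θ : ℝ := 2 * (π / M i j) with hθ
  have hsin : Real.sin θ ≠ 0 := by
    apply ne_of_gt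
    apply Real.sin_pos_of_pos_of_lt_pi
    · positivity
    · rw [hθ, ← mul_div_assoc, div_lt_iff₀ (by linarith)]
      nlinarith [pi_pos]
  have ht : M.coroot i (Pi.single j 1) * M.coroot j (Pi.single i 1) - 2 = 2 * Real.cos θ := by
    rw [coroot_apply, coroot_apply, cosForm_single, cosForm_single, M.cosine_comm j i, hθ,
      Real.cos_two_mul, cosine]
    ring
  have hS (n : ℤ) : (Polynomial.Chebyshev.S ℝ n).eval (2 * Real.cos θ) =
      Real.sin ((n + 1) * θ) / Real.sin θ := by
    rw [eq_div_iff hsin, Polynomial.Chebyshev.S_two_mul_real_cos]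
  have hMθ : (M i j : ℝ) * θ = 2 * π := by
    rw [hθ]; field_simp
  ext1 v
  rw [simpleReflection, simpleReflection, Module.reflection_mul_reflection_pow_apply _ _ _ _
    _ ht.symm]
  obtain ⟨h, hh | hh⟩ := Nat.even_or_odd' (M i j)
  · have e1 : ((M i j : ℤ) - 2) / 2 = h - 1 := by omega
    have e2 : ((M i j : ℤ) - 1) / 2 = h - 1 := by omega
    have hz : Real.sin ((((h : ℤ) - 1 : ℤ) + 1 : ℝ) * θ) = 0 := by
      have : (((h : ℤ) - 1 : ℤ) + 1 : ℝ) * θ = π := by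
        rw [hh] at hMθ
        push_cast at hMθ ⊢
        linarith
      rw [this, Real.sin_pi]
    rw [e1, e2, hS, hz]
    simp
  · have e1 : ((M i j : ℤ) - 2) / 2 = h - 1 := by omega
    have e2 : ((M i j : ℤ) - 1) / 2 = h := by omega
    have e3 : ((M i j : ℤ) - 3) / 2 = h - 1 := by omega
    have e4 : (M i j : ℤ) / 2 = h := by omega
    have hz : Real.sin (((h : ℤ) + 1 : ℝ) * θ) = -Real.sin ((((h : ℤ) - 1 : ℤ) + 1 : ℝ) * θ) := by
      have : ((h : ℤ) + 1 : ℝ) * θ = 2 * π - (((h : ℤ) - 1 : ℤ) + 1 : ℝ) * θ := by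
        rw [hh] at hMθ
        push_cast at hMθ ⊢
        linarith
      rw [this, Real.sin_two_pi_sub]
    rw [e1, e2, e3, e4, hS, hS, hz]
    simp [neg_div]

end CoxeterMatrix

namespace CoxeterSystem

open Real

variable {B W : Type*} [Fintype B] [DecidableEq B] [Group W] {M : CoxeterMatrix B} [M.IsLarge]
  (cs : CoxeterSystem M W)

/-- The geometric representation. -/
noncomputable def geomRep : W →* ((B → ℝ) ≃ₗ[ℝ] (B → ℝ)) :=
  cs.lift ⟨M.simpleReflection, M.isLiftable_simpleReflection⟩

theorem geomRep_simple (i : B) : cs.geomRep (cs.simple i) = M.simpleReflection i :=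
  cs.lift_apply_simple _ i

theorem geomRep_simple_apply (i : B) (v : B → ℝ) : cs.geomRep (cs.simple i) v =
    v - (2 * M.cosForm (Pi.single i 1) v) • Pi.single i 1 := by
  rw [geomRep_simple, M.simpleReflection_apply]

theorem geomRep_mul_apply (g h : W) (v : B → ℝ) :
    cs.geomRep (g * h) v = cs.geomRep g (cs.geomRep h v) := by
  rw [map_mul, LinearEquiv.mul_apply]

theorem geomRep_one_apply (v : B → ℝ) : cs.geomRep 1 v = v := by
  rw [map_one, LinearEquiv.coe_one, id]

theorem geomRep_inv_apply_self (g : W) (v : B → ℝ) :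
    cs.geomRep g⁻¹ (cs.geomRep g v) = v := by
  rw [← geomRep_mul_apply, inv_mul_cancel, geomRep_one_apply]

theorem geomRep_apply_inv_self (g : W) (v : B → ℝ) :
    cs.geomRep g (cs.geomRep g⁻¹ v) = v := by
  rw [← geomRep_mul_apply, mul_inv_cancel, geomRep_one_apply]

theorem geomRep_simple_self (i : B) :
    cs.geomRep (cs.simple i) (Pi.single i 1) = -Pi.single i 1 := by
  rw [geomRep_simple_apply, M.cosForm_single_self, mul_one, two_smul]
  abel

theorem geomRep_simple_single (i j : B) : cs.geomRep (cs.simple i) (Pi.single j 1) =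
    Pi.single j 1 + (2 * M.cosine i j) • Pi.single i 1 := by
  rw [geomRep_simple_apply, M.cosForm_single, mul_neg, neg_smul, sub_neg_eq_add]

theorem cosForm_geomRep (g : W) (u v : B → ℝ) :
    M.cosForm (cs.geomRep g u) (cs.geomRep g v) = M.cosForm u v := by
  induction g using cs.simple_induction_left generalizing u v with
  | one => simp only [geomRep_one_apply]
  | mul_simple_left g i ih =>
    rw [geomRep_mul_apply, geomRep_mul_apply, ← ih u v]
    generalize cs.geomRep g u = u
    generalize cs.geomRep g v = v
    rw [geomRep_simple_apply, geomRep_simple_apply]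
    simp only [map_sub, map_smul, LinearMap.sub_apply, LinearMap.smul_apply, smul_eq_mul,
      M.cosForm_single_self, M.cosForm_comm u (Pi.single i 1)]
    ring

theorem cosForm_geomRep_left (g : W) (u v : B → ℝ) :
    M.cosForm (cs.geomRep g u) v = M.cosForm u (cs.geomRep g⁻¹ v) := by
  conv_lhs => rw [← cs.geomRep_apply_inv_self g v]
  rw [cosForm_geomRep]

end CoxeterSystem

/-! ### Positive and negative roots, and walls separating chambers. -/

namespace CoxeterSystem

theorem exists_maximal_alternatingWord_suffix {B W : Type*} [Group W] {M : CoxeterMatrix B}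
    (cs : CoxeterSystem M W) (g : W) (i j : B) :
    ∃ (q : ℕ) (v : W), g = v * cs.wordProd (alternatingWord i j q) ∧
      cs.length g = cs.length v + q ∧
      ∀ v' : W, g = v' * cs.wordProd (alternatingWord i j (q + 1)) →
        cs.length g ≠ cs.length v' + (q + 1) := by
  classical
  let P : ℕ → Prop := fun q => ∃ v : W, g = v * cs.wordProd (alternatingWord i j q) ∧
      cs.length g = cs.length v + q
  have h0 : P 0 := ⟨g, by simp [alternatingWord]⟩
  obtain ⟨v, hv⟩ := Nat.findGreatest_spec (P := P) (Nat.zero_le (cs.length g)) h0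
  refine ⟨_, v, hv.1, hv.2, fun v' h1 h2 => ?_⟩
  exact Nat.findGreatest_is_greatest (P := P) (n := cs.length g) (Nat.lt_succ_self _)
    (by omega) ⟨v', h1, h2⟩

open Real

variable {B W : Type*} [Fintype B] [DecidableEq B] [Group W] {M : CoxeterMatrix B} [M.IsLarge]
  (cs : CoxeterSystem M W)

theorem geomRep_alternatingWord {i j : B} (hij : i ≠ j) (q : ℕ) :
    cs.geomRep (cs.wordProd (alternatingWord i j q)) (Pi.single i 1) =
      (Real.sin ((q + 1) * (π / M i j)) / Real.sin (π / M i j)) •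
        Pi.single (if Even q then i else j) 1 +
      (Real.sin (q * (π / M i j)) / Real.sin (π / M i j)) •
        Pi.single (if Even q then j else i) 1 := by
  set θ : ℝ := π / M i j with hθ
  have h3' : (3 : ℝ) ≤ M i j := by exact_mod_cast CoxeterMatrix.IsLarge.three_le (M := M) hij
  have hsin : Real.sin θ ≠ 0 := by
    apply ne_of_gt
    apply Real.sin_pos_of_pos_of_lt_pi
    · positivity
    · exact div_lt_self pi_pos (by linarith)
  have hc : M.cosine i j = Real.cos θ := rfl
  have hc' : M.cosine j i = Real.cos θ := by rw [M.cosine_comm, hc]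
  induction q with
  | zero => simp [alternatingWord, div_self hsin]
  | succ q ih =>
    have key : 2 * Real.cos θ * Real.sin ((q + 1) * θ) =
        Real.sin ((q + 1 + 1) * θ) + Real.sin (q * θ) := by
      rw [show ((q : ℝ) + 1 + 1) * θ = (q + 1) * θ + θ by ring,
        show (q : ℝ) * θ = (q + 1) * θ - θ by ring, Real.sin_add, Real.sin_sub]
      ring
    rw [alternatingWord_succ', wordProd_cons, geomRep_mul_apply, ih, map_add, map_smul, map_smul]
    push_cast
    by_cases hq : Even q
    · have hq' : ¬ Even (q + 1) := by simp [hq, Nat.even_add_one]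
      simp only [hq, hq', if_true, if_false]
      rw [geomRep_simple_self, geomRep_simple_single, hc']
      match_scalars <;> field_simp
      rw [mul_comm θ]
      linarith
    · have hq' : Even (q + 1) := by simp [hq, Nat.even_add_one]
      simp only [hq, hq', if_true, if_false]
      rw [geomRep_simple_self, geomRep_simple_single, hc]
      match_scalars <;> field_simp
      rw [mul_comm θ]
      linarith

theorem geomRep_alternatingWord_nonneg {i j : B} (hij : i ≠ j) {q : ℕ} (hq : q + 1 ≤ M i j) :
    ∃ a b : ℝ, 0 ≤ a ∧ 0 ≤ b ∧
      cs.geomRep (cs.wordProd (alternatingWord i j q)) (Pi.single i 1) =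
        a • Pi.single i 1 + b • Pi.single j 1 := by
  have hM : (0 : ℝ) < M i j := by exact_mod_cast (by omega : 0 < M i j)
  have hnn (k : ℕ) (hk : k ≤ M i j) :
      0 ≤ Real.sin (k * (π / M i j)) / Real.sin (π / M i j) := by
    have h1 : (1 : ℝ) ≤ M i j := by exact_mod_cast (by omega : 1 ≤ M i j)
    have h2 : (k : ℝ) ≤ M i j := by exact_mod_cast hk
    apply div_nonneg <;> apply Real.sin_nonneg_of_nonneg_of_le_pi
    · positivity
    · rw [← mul_div_assoc, div_le_iff₀ hM]
      nlinarith [pi_pos]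
    · positivity
    · exact div_le_self pi_pos.le h1
  have h1 := hnn (q + 1) hq
  have h2 := hnn q (by omega)
  push_cast at h1
  rw [cs.geomRep_alternatingWord hij]
  by_cases hq : Even q
  · simp only [hq, if_true]
    exact ⟨_, _, h1, h2, rfl⟩
  · simp only [hq, if_false]
    exact ⟨_, _, h2, h1, add_comm _ _⟩

/-- Induction on length. Split off from `g` a maximal reduced tail in the letters `i`, `j`, where
`j` is a descent. The remaining factor `v` is shorter and has neither `i` nor `j` as a descent, so
it keeps both simple roots positive, while the tail sends the `i`-th simple root to a nonnegative
combination of these two. -/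
theorem geomRep_single_nonneg_of_length_lt (g : W) (i : B)
    (h : cs.length g < cs.length (g * cs.simple i)) :
    0 ≤ cs.geomRep g (Pi.single i 1) := by
  induction hn : cs.length g using Nat.strong_induction_on generalizing g i with
  | _ n ih =>
  rcases eq_or_ne g 1 with rfl | hg
  · rw [geomRep_one_apply]
    simp
  obtain ⟨j, hj⟩ := cs.exists_rightDescent_of_ne_one hg
  have hij : i ≠ j := by
    rintro rfl
    exact absurd hj (by unfold IsRightDescent; omega)
  obtain ⟨q, v, hv, hlen, hmax⟩ := cs.exists_maximal_alternatingWord_suffix g i j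
  have hq : q ≠ 0 := by
    rintro rfl
    refine hmax (g * cs.simple j) ?_ ?_
    · simp [alternatingWord]
    · have := cs.isRightDescent_iff.1 hj
      omega
  obtain ⟨p, rfl⟩ := Nat.exists_eq_succ_of_ne_zero hq
  rw [Nat.succ_eq_add_one] at *
  have hnext : cs.length v < cs.length (v * cs.simple (if Even (p + 1) then j else i)) := by
    rcases cs.length_mul_simple v (if Even (p + 1) then j else i) with h1 | h1
    · omega
    · exfalso
      refine hmax (v * cs.simple (if Even (p + 1) then j else i)) ?_ (by omega)
      rw [alternatingWord_succ' i j (p + 1), wordProd_cons, ← mul_assoc,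
        simple_mul_simple_cancel_right, hv]
  have hother : cs.length v < cs.length (v * cs.simple (if Even p then j else i)) := by
    rcases cs.length_mul_simple v (if Even p then j else i) with h1 | h1
    · omega
    · exfalso
      rw [alternatingWord_succ', wordProd_cons, ← mul_assoc] at hv
      have h2 := cs.length_mul_le (v * cs.simple (if Even p then j else i))
        (cs.wordProd (alternatingWord i j p))
      have h3 := cs.length_wordProd_le (alternatingWord i j p)
      rw [length_alternatingWord] at h3
      rw [← hv] at h2
      omega
  have hboth : 0 ≤ cs.geomRep v (Pi.single i 1) ∧ 0 ≤ cs.geomRep v (Pi.single j 1) := by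
    have hi' : ∀ k, cs.length v < cs.length (v * cs.simple k) →
        0 ≤ cs.geomRep v (Pi.single k 1) := fun k hk =>
      ih (cs.length v) (by omega) v k hk rfl
    by_cases hp : Even p
    · have hp' : ¬ Even (p + 1) := by simp [hp, Nat.even_add_one]
      simp only [hp, hp', if_true, if_false] at hnext hother
      exact ⟨hi' _ hnext, hi' _ hother⟩
    · have hp' : Even (p + 1) := by simp [hp, Nat.even_add_one]
      simp only [hp, hp', if_true, if_false] at hnext hother
      exact ⟨hi' _ hother, hi' _ hnext⟩
  -- Otherwise the tail times `s i` is an alternating word longer than `M i j`, hence not reduced,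
  -- and `g * s i` could not be longer than `g`.
  have hle : p + 1 + 1 ≤ M i j := by
    by_contra hlt
    have hred : ¬ cs.IsReduced (alternatingWord j i (p + 1 + 1)) :=
      cs.not_isReduced_alternatingWord j i (M.ne_zero_of_isLarge j i)
        (by rw [M.symmetric j i]; omega)
    apply hred
    have h1 := cs.length_wordProd_le (alternatingWord j i (p + 1 + 1))
    rw [length_alternatingWord] at h1
    have h2 : g * cs.simple i = v * cs.wordProd (alternatingWord j i (p + 1 + 1)) := by
      rw [alternatingWord_succ j i, wordProd_concat, ← mul_assoc, ← hv]
    have h3 := cs.length_mul_le v (cs.wordProd (alternatingWord j i (p + 1 + 1)))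
    rw [← h2] at h3
    rw [IsReduced, length_alternatingWord]
    omega
  obtain ⟨a, b, ha, hb, hab⟩ := cs.geomRep_alternatingWord_nonneg hij hle
  rw [hv, geomRep_mul_apply, hab, map_add, map_smul, map_smul]
  exact add_nonneg (smul_nonneg ha hboth.1) (smul_nonneg hb hboth.2)

theorem geomRep_single_nonpos_of_length_lt (g : W) (i : B)
    (h : cs.length (g * cs.simple i) < cs.length g) :
    cs.geomRep g (Pi.single i 1) ≤ 0 := by
  have := cs.geomRep_single_nonneg_of_length_lt (g * cs.simple i) i
    (by rwa [simple_mul_simple_cancel_right])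
  rw [geomRep_mul_apply, geomRep_simple_self, map_neg] at this
  exact neg_nonneg.1 this

/-- A root is an image of a simple root under the group. -/
def IsRoot (β : B → ℝ) : Prop := ∃ (g : W) (i : B), β = cs.geomRep g (Pi.single i 1)

variable {cs}

theorem isRoot_single (i : B) : cs.IsRoot (Pi.single i 1) := ⟨1, i, by rw [geomRep_one_apply]⟩

theorem IsRoot.geomRep {β : B → ℝ} (h : cs.IsRoot β) (g : W) : cs.IsRoot (cs.geomRep g β) := by
  obtain ⟨x, i, rfl⟩ := h
  exact ⟨g * x, i, by rw [geomRep_mul_apply]⟩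

theorem IsRoot.neg {β : B → ℝ} (h : cs.IsRoot β) : cs.IsRoot (-β) := by
  obtain ⟨x, i, rfl⟩ := h
  exact ⟨x * cs.simple i, i, by rw [geomRep_mul_apply, geomRep_simple_self, map_neg]⟩

theorem IsRoot.cosForm_self {β : B → ℝ} (h : cs.IsRoot β) : M.cosForm β β = 1 := by
  obtain ⟨x, i, rfl⟩ := h
  rw [cosForm_geomRep, M.cosForm_single_self]

theorem IsRoot.ne_zero {β : B → ℝ} (h : cs.IsRoot β) : β ≠ 0 := by
  rintro rfl
  have := h.cosForm_self
  simp at this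

theorem IsRoot.nonneg_or_nonpos {β : B → ℝ} (h : cs.IsRoot β) : 0 ≤ β ∨ β ≤ 0 := by
  obtain ⟨x, i, rfl⟩ := h
  rcases cs.length_mul_simple x i with h1 | h1
  · exact Or.inl (cs.geomRep_single_nonneg_of_length_lt x i (by omega))
  · exact Or.inr (cs.geomRep_single_nonpos_of_length_lt x i (by omega))

theorem IsRoot.not_nonneg {β : B → ℝ} (h : cs.IsRoot β) : ¬ 0 ≤ β ↔ β ≤ 0 := by
  refine ⟨fun h1 => h.nonneg_or_nonpos.resolve_left h1, fun h1 h2 => ?_⟩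
  exact h.ne_zero (le_antisymm h1 h2)

theorem IsRoot.not_nonpos {β : B → ℝ} (h : cs.IsRoot β) : ¬ β ≤ 0 ↔ 0 ≤ β := by
  rw [← h.not_nonneg, not_not]

/-- A simple reflection permutes the positive roots other than its own simple root. -/
theorem IsRoot.eq_single_of_simple_nonpos {β : B → ℝ} (h : cs.IsRoot β) (hβ : 0 ≤ β) {i : B}
    (hi : cs.geomRep (cs.simple i) β ≤ 0) : β = Pi.single i 1 := by
  have hz : ∀ j, j ≠ i → β j = 0 := by
    intro j hj
    have h1 := hi j
    rw [geomRep_simple_apply] at h1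
    simp [hj] at h1
    exact le_antisymm h1 (hβ j)
  have he : β = β i • Pi.single i 1 := by
    ext j
    rcases eq_or_ne j i with rfl | hj
    · simp
    · simp [hz j hj, hj]
  have h1 := h.cosForm_self
  have h2 := hβ i
  rw [he] at h1 ⊢
  simp only [map_smul, LinearMap.smul_apply, M.cosForm_single_self, smul_eq_mul, mul_one] at h1
  have h3 : β i = 1 := by
    simp only [Pi.zero_apply] at h2
    nlinarith
  rw [h3, one_smul]

variable (cs)

theorem eq_one_of_geomRep_single_nonneg {g : W}
    (h : ∀ i, 0 ≤ cs.geomRep g (Pi.single i 1)) : g = 1 := by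
  by_contra hg
  obtain ⟨j, hj⟩ := cs.exists_rightDescent_of_ne_one hg
  have h1 := cs.geomRep_single_nonpos_of_length_lt g j hj
  exact ((isRoot_single (cs := cs) j).geomRep g).not_nonneg.2 h1 (h j)

theorem finite_inversions (u : W) :
    {β : B → ℝ | cs.IsRoot β ∧ 0 ≤ β ∧ cs.geomRep u⁻¹ β ≤ 0}.Finite := by
  induction u using cs.simple_induction_right with
  | one =>
    refine Set.Finite.subset Set.finite_empty ?_
    rintro β ⟨h1, h2, h3⟩
    rw [inv_one, geomRep_one_apply] at h3
    exact h1.ne_zero (le_antisymm h3 h2)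
  | mul_simple_right u i ih =>
    refine (ih.insert (cs.geomRep u (Pi.single i 1))).subset ?_
    rintro β ⟨h1, h2, h3⟩
    rw [mul_inv_rev, inv_simple, geomRep_mul_apply] at h3
    by_cases h4 : cs.geomRep u⁻¹ β ≤ 0
    · exact Or.inr ⟨h1, h2, h4⟩
    · left
      rw [← (h1.geomRep _).eq_single_of_simple_nonpos ((h1.geomRep _).not_nonpos.1 h4) h3,
        geomRep_apply_inv_self]

/-- Finitely many walls separate two chambers. -/
theorem finite_separating (x y : W) :
    {β : B → ℝ | cs.IsRoot β ∧ 0 ≤ cs.geomRep x⁻¹ β ∧ cs.geomRep y⁻¹ β ≤ 0}.Finite := by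
  refine ((cs.finite_inversions (x⁻¹ * y)).image (cs.geomRep x)).subset ?_
  rintro β ⟨h1, h2, h3⟩
  refine ⟨cs.geomRep x⁻¹ β, ⟨h1.geomRep _, h2, ?_⟩, geomRep_apply_inv_self _ _ _⟩
  rwa [← geomRep_mul_apply, mul_inv_rev, inv_inv, mul_assoc, mul_inv_cancel, mul_one]

variable {cs} in
/-- The reflection in a root maps roots to roots. -/
theorem IsRoot.reflection {β v : B → ℝ} (hβ : cs.IsRoot β) (hv : cs.IsRoot v) :
    cs.IsRoot (v - (2 * M.cosForm β v) • β) := by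
  obtain ⟨g, i, rfl⟩ := hβ
  have : v - (2 * M.cosForm (cs.geomRep g (Pi.single i 1)) v) • cs.geomRep g (Pi.single i 1) =
      cs.geomRep (g * cs.simple i * g⁻¹) v := by
    rw [geomRep_mul_apply, geomRep_mul_apply, geomRep_simple_apply, map_sub, map_smul,
      geomRep_apply_inv_self, cosForm_geomRep_left]
  rw [this]
  exact hv.geomRep _

variable {cs} in
theorem IsRoot.sum_pos {β : B → ℝ} (h : cs.IsRoot β) (hβ : 0 ≤ β) : 0 < ∑ i, β i := by
  refine lt_of_le_of_ne (Finset.sum_nonneg fun i _ => hβ i) fun h0 => h.ne_zero ?_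
  ext i
  exact (Finset.sum_eq_zero_iff_of_nonneg fun i _ => hβ i).1 h0.symm i (Finset.mem_univ i)

/-- If `⟨γ, δ⟩ ≤ -1`, the half-spaces of `γ` and `δ` are nested or disjoint. -/
theorem not_separating_of_cosForm_le {γ δ : B → ℝ} (hγ : cs.IsRoot γ) (hδ : cs.IsRoot δ)
    (h : M.cosForm γ δ ≤ -1) {x y : W} (hxγ : 0 ≤ cs.geomRep x⁻¹ γ)
    (hxδ : 0 ≤ cs.geomRep x⁻¹ δ) (hyγ : cs.geomRep y⁻¹ γ ≤ 0) (hyδ : cs.geomRep y⁻¹ δ ≤ 0) :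
    False := by
  obtain ⟨c, hc⟩ : ∃ c, c = -M.cosForm γ δ := ⟨_, rfl⟩
  have hc1 : 1 ≤ c := by linarith
  -- `σ, τ` stand for consecutive terms of the sequence `γ, 2cγ + δ, …` with rule `2cτ - σ`,
  -- produced by the reflections in `γ` and `δ`. Since `c ≥ 1`, every term separates `x` from `y`
  -- and the coefficient sum seen from `x` strictly increases. As only finitely many roots separate
  -- `x` from `y`, a term with maximal sum exists, and its successor contradicts maximality.
  let Inv (σ τ : B → ℝ) : Prop := cs.IsRoot σ ∧ cs.IsRoot τ ∧ M.cosForm σ τ = c ∧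
    0 ≤ cs.geomRep x⁻¹ σ ∧ 0 ≤ cs.geomRep x⁻¹ (τ - σ) ∧
    0 < ∑ i, cs.geomRep x⁻¹ (τ - σ) i ∧
    cs.geomRep y⁻¹ σ ≤ 0 ∧ cs.geomRep y⁻¹ (τ - σ) ≤ 0
  have hle : ∀ σ τ, Inv σ τ → 0 ≤ cs.geomRep x⁻¹ τ ∧ cs.geomRep y⁻¹ τ ≤ 0 := by
    rintro σ τ ⟨-, -, -, h4, h5, -, h7, h8⟩
    have h9 := add_nonneg h5 h4
    have h10 := add_nonpos h8 h7
    rw [← map_add, sub_add_cancel] at h9 h10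
    exact ⟨h9, h10⟩
  have hfin : {τ | ∃ σ, Inv σ τ}.Finite := by
    refine (cs.finite_separating x y).subset ?_
    rintro τ ⟨σ, hστ⟩
    exact ⟨hστ.2.1, hle σ τ hστ⟩
  have hne : {τ | ∃ σ, Inv σ τ}.Nonempty := by
    have e1 : (2 * c) • γ + δ - γ = (2 * c - 1) • γ + δ := by module
    refine ⟨(2 * c) • γ + δ, γ, hγ, ?_, ?_, hxγ, ?_, ?_, hyγ, ?_⟩
    · have := hγ.reflection hδ
      rwa [show δ - (2 * M.cosForm γ δ) • γ = (2 * c) • γ + δ by rw [hc]; module] at this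
    · rw [map_add, map_smul, hγ.cosForm_self, smul_eq_mul]
      linarith
    · rw [e1, map_add, map_smul]
      exact add_nonneg (smul_nonneg (by linarith) hxγ) hxδ
    · rw [e1, map_add, map_smul]
      simp only [Pi.add_apply, Pi.smul_apply, Finset.sum_add_distrib, smul_eq_mul,
        ← Finset.mul_sum]
      have h1 := (hγ.geomRep x⁻¹).sum_pos hxγ
      have h2 := (hδ.geomRep x⁻¹).sum_pos hxδ
      nlinarith
    · rw [e1, map_add, map_smul]
      exact add_nonpos (smul_nonpos_of_nonneg_of_nonpos (by linarith) hyγ) hyδ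
  obtain ⟨τ, ⟨σ, hστ⟩, hmax⟩ := Set.exists_max_image _
    (fun τ => ∑ i, cs.geomRep x⁻¹ τ i) hfin hne
  obtain ⟨h9, h10⟩ := hle σ τ hστ
  obtain ⟨h1, h2, h3, h4, h5, h6, h7, h8⟩ := hστ
  have e1 : (2 * c) • τ - σ - τ = (2 * c - 2) • τ + (τ - σ) := by module
  have hpos : 0 < ∑ i, cs.geomRep x⁻¹ ((2 * c) • τ - σ - τ) i := by
    rw [e1, map_add, map_smul]
    simp only [Pi.add_apply, Pi.smul_apply, Finset.sum_add_distrib, smul_eq_mul,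
        ← Finset.mul_sum]
    have h11 := (h2.geomRep x⁻¹).sum_pos h9
    nlinarith
  have := hmax ((2 * c) • τ - σ) ⟨τ, h2, ?_, ?_, h9, ?_, hpos, h10, ?_⟩
  · rw [map_sub] at hpos
    simp only [Pi.sub_apply, Finset.sum_sub_distrib] at hpos
    linarith
  · have := (h2.reflection h1).neg
    rwa [M.cosForm_comm, h3, neg_sub] at this
  · rw [map_sub, map_smul, h2.cosForm_self, M.cosForm_comm, h3, smul_eq_mul]
    ring
  · rw [e1, map_add, map_smul]
    exact add_nonneg (smul_nonneg (by linarith) h9) h5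
  · rw [e1, map_add, map_smul]
    exact add_nonpos (smul_nonpos_of_nonneg_of_nonpos (by linarith) h10) h8

end CoxeterSystem

/-! ### Counting quasimorphisms for patterns of half-spaces -/

namespace CountingPattern

variable {G ι : Type*} [Group G] (P : ι → Set G)

/-- All members of the translate of the pattern by `g'` are contained in all members of the
translate by `g`. -/
def Precedes (g g' : G) : Prop := ∀ (i j : ι) (x : G), g'⁻¹ * x ∈ P j → g⁻¹ * x ∈ P i

/-- A chain of translates of the pattern, each of which separates `A` from `B`. -/
def IsChain (A B : Set G) (l : List G) : Prop :=
  l.Pairwise (Precedes P) ∧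
    ∀ g ∈ l, ∀ i, (∀ a ∈ A, g⁻¹ * a ∉ P i) ∧ ∀ b ∈ B, g⁻¹ * b ∈ P i

/-- The largest length of a chain of translates separating `A` from `B`. -/
noncomputable def count (A B : Set G) : ℕ := sSup {k | ∃ l, IsChain P A B l ∧ l.length = k}

/-- The antisymmetrized count. -/
noncomputable def height (x y : G) : ℤ := (count P {x} {y} : ℤ) - count P {y} {x}

variable {P}

theorem Precedes.trans [Nonempty ι] {g g' g'' : G} (h : Precedes P g g')
    (h' : Precedes P g' g'') : Precedes P g g'' := fun i j x hx =>
  h i (Classical.arbitrary ι) x (h' _ j x hx)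

theorem Precedes.mul_left {g g' : G} (h : Precedes P g g') (a : G) :
    Precedes P (a * g) (a * g') := by
  intro i j x hx
  rw [mul_inv_rev, mul_assoc] at hx ⊢
  exact h i j _ hx

theorem IsChain.mono {A A' B B' : Set G} {l : List G} (h : IsChain P A B l) (hA : A' ⊆ A)
    (hB : B' ⊆ B) : IsChain P A' B' l :=
  ⟨h.1, fun g hg i => ⟨fun a ha => (h.2 g hg i).1 a (hA ha), fun b hb => (h.2 g hg i).2 b (hB hb)⟩⟩

theorem IsChain.map_mul_left {x y : G} {l : List G} (h : IsChain P {x} {y} l) (g : G) :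
    IsChain P {g * x} {g * y} (l.map (g * ·)) := by
  refine ⟨List.pairwise_map.2 (h.1.imp fun h => h.mul_left g), ?_⟩
  intro a ha i
  obtain ⟨b, hb, rfl⟩ := List.mem_map.1 ha
  have := h.2 b hb i
  simpa [mul_assoc] using this

-- Boundedness makes `count` a true maximum; the supremum of an unbounded set of naturals would be
-- 0.
variable (hb : ∀ x y : G, ∃ C, ∀ l, IsChain P {x} {y} l → l.length ≤ C)
include hb

theorem IsChain.length_le_count {A B : Set G} (hA : A.Nonempty) (hB : B.Nonempty) {l : List G}
    (h : IsChain P A B l) : l.length ≤ count P A B := by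
  obtain ⟨x, hx⟩ := hA
  obtain ⟨y, hy⟩ := hB
  obtain ⟨C, hC⟩ := hb x y
  refine le_csSup ⟨C, ?_⟩ ⟨l, h, rfl⟩
  rintro k ⟨l, hl, rfl⟩
  exact hC l (hl.mono (by simpa using hx) (by simpa using hy))

theorem exists_isChain_length_eq_count {A B : Set G} (hA : A.Nonempty) (hB : B.Nonempty) :
    ∃ l, IsChain P A B l ∧ l.length = count P A B := by
  obtain ⟨x, hx⟩ := hA
  obtain ⟨y, hy⟩ := hB
  obtain ⟨C, hC⟩ := hb x y
  refine Nat.sSup_mem (s := {k | ∃ l, IsChain P A B l ∧ l.length = k})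
    ⟨0, [], ⟨List.Pairwise.nil, by simp⟩, rfl⟩ ⟨C, ?_⟩
  rintro k ⟨l, hl, rfl⟩
  exact hC l (hl.mono (by simpa using hx) (by simpa using hy))

theorem count_mul_left (g x y : G) : count P {g * x} {g * y} = count P {x} {y} := by
  have key : ∀ g x y : G, count P {x} {y} ≤ count P {g * x} {g * y} := by
    intro g x y
    obtain ⟨l, hl, he⟩ := exists_isChain_length_eq_count hb (Set.singleton_nonempty x)
      (Set.singleton_nonempty y)
    rw [← he, ← List.length_map (f := (g * ·))]
    exact (hl.map_mul_left g).length_le_count hb (Set.singleton_nonempty _)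
      (Set.singleton_nonempty _)
  refine le_antisymm ?_ (key g x y)
  simpa using key g⁻¹ (g * x) (g * y)

theorem height_mul_left (g x y : G) : height P (g * x) (g * y) = height P x y := by
  rw [height, height, count_mul_left hb, count_mul_left hb]

/-- Translation by `t` exchanges `1` and `t`, and the height is antisymmetric. -/
theorem height_one_of_mul_self {t : G} (ht : t * t = 1) : height P 1 t = 0 := by
  have := height_mul_left hb t 1 t
  rw [mul_one, ht, height, height] at this
  rw [height]
  omega

/-- At most one member of a chain from `x` to `y` is cut by `z`. -/
theorem count_le (x y z : G) :
    count P {x} {y} ≤ count P {x} {y, z} + count P {x, z} {y} + 1 := by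
  classical
  obtain ⟨l, hl, he⟩ := exists_isChain_length_eq_count hb (Set.singleton_nonempty x)
    (Set.singleton_nonempty y)
  let p : G → Bool := fun g => decide (∀ i, g⁻¹ * z ∈ P i)
  let q : G → Bool := fun g => decide (∀ i, g⁻¹ * z ∉ P i)
  have h1 : IsChain P {x} {y, z} (l.filter p) := by
    refine ⟨hl.1.filter _, fun g hg i => ?_⟩
    rw [List.mem_filter, decide_eq_true_iff] at hg
    have := hl.2 g hg.1 i
    exact ⟨this.1, by simpa using ⟨by simpa using this.2, hg.2 i⟩⟩
  have h2 : IsChain P {x, z} {y} ((l.filter (fun g => !p g)).filter q) := by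
    refine ⟨(hl.1.filter _).filter _, fun g hg i => ?_⟩
    rw [List.mem_filter, List.mem_filter, decide_eq_true_iff] at hg
    have := hl.2 g hg.1.1 i
    exact ⟨by simpa using ⟨by simpa using this.1, hg.2 i⟩, this.2⟩
  -- If `z` lies in some half-space of a member of the chain, it lies in all half-spaces of every
  -- earlier member; so two members cannot both be cut by `z`.
  have h3 : ((l.filter (fun g => !p g)).filter (fun g => !q g)).length ≤ 1 := by
    by_contra hlt
    have hpw : ((l.filter (fun g => !p g)).filter (fun g => !q g)).Pairwise (Precedes P) :=
      (hl.1.filter _).filter _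
    have hmem : ∀ g ∈ (l.filter (fun g => !p g)).filter (fun g => !q g),
        (∃ i, g⁻¹ * z ∉ P i) ∧ ∃ i, g⁻¹ * z ∈ P i := by
      intro g hg
      simpa [p, q] using (by simpa only [List.mem_filter] using hg :
        (g ∈ l ∧ (!p g) = true) ∧ (!q g) = true).imp And.right id
    match hm : (l.filter (fun g => !p g)).filter (fun g => !q g) with
    | [] => simp [hm] at hlt
    | [_] => simp [hm] at hlt
    | a :: b :: l' =>
      rw [hm] at hpw hmem
      obtain ⟨⟨i, hi⟩, -⟩ := hmem a (by simp)
      obtain ⟨-, ⟨j, hj⟩⟩ := hmem b (by simp)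
      exact hi ((List.pairwise_cons.1 hpw).1 b (by simp) i j z hj)
  have h4 := h1.length_le_count hb (by simp) (by simp)
  have h5 := h2.length_le_count hb (by simp) (by simp)
  have h6 := List.length_eq_length_filter_add (l := l) p
  have h7 := List.length_eq_length_filter_add (l := l.filter (fun g => !p g)) q
  omega

-- The pattern and any translate of it contain two half-spaces that do not cross: one of the four
-- quadrants is empty.
variable (hS : ∀ g : G, ∃ k l, ¬ ((∃ x, x ∉ P k ∧ g⁻¹ * x ∉ P l) ∧ (∃ x, x ∈ P k ∧ g⁻¹ * x ∉ P l) ∧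
  (∃ x, x ∉ P k ∧ g⁻¹ * x ∈ P l) ∧ ∃ x, x ∈ P k ∧ g⁻¹ * x ∈ P l))
include hS

/-- Concatenate the two chains after dropping the last member `g1` of the first and the first member
`g2` of the second. For the non-crossing pair supplied by `hS`, the points `x`, `y`, `z` occupy
three of the quadrants, so the empty one forces a half-space of `g2` into one of `g1`. The two
dropped members serve as buffers that transmit this inclusion to all remaining half-spaces. -/
theorem le_count (x y z : G) :
    count P {x} {y, z} + count P {x, z} {y} ≤ count P {x} {y} + 2 := by
  obtain ⟨l1, hl1, he1⟩ := exists_isChain_length_eq_count hb (Set.singleton_nonempty x)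
    (Set.insert_nonempty y {z})
  obtain ⟨l2, hl2, he2⟩ := exists_isChain_length_eq_count hb (Set.insert_nonempty x {z})
    (Set.singleton_nonempty y)
  have hch : IsChain P {x} {y} (l1.dropLast ++ l2.tail) := by
    constructor
    · rw [List.pairwise_append]
      refine ⟨hl1.1.sublist (List.dropLast_sublist _), hl2.1.sublist (List.tail_sublist _), ?_⟩
      intro a ha b hb'
      rcases List.eq_nil_or_concat l1 with rfl | ⟨l1', g1, rfl⟩
      · simp at ha
      match l2 with
      | [] => simp at hb'
      | g2 :: l2' =>
        simp only [List.concat_eq_append, List.dropLast_concat, List.tail_cons] at ha hb' hl1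
        have ha1 : Precedes P a g1 := (List.pairwise_append.1 hl1.1).2.2 a ha g1 (by simp)
        have hb1 : Precedes P g2 b := (List.pairwise_cons.1 hl2.1).1 b hb'
        obtain ⟨k, l, hkl⟩ := hS (g1⁻¹ * g2)
        have hg1 := hl1.2 g1 (by simp) k
        have hg2 := hl2.2 g2 (by simp) l
        simp only [Set.mem_singleton_iff, Set.mem_insert_iff, forall_eq_or_imp, forall_eq] at hg1 hg2
        have hsub : ∀ p, g2⁻¹ * p ∈ P l → g1⁻¹ * p ∈ P k := by
          intro p hp
          by_contra hp'
          refine hkl ⟨⟨g1⁻¹ * x, hg1.1, ?_⟩, ⟨g1⁻¹ * z, hg1.2.2, ?_⟩, ⟨g1⁻¹ * p, hp', ?_⟩,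
            ⟨g1⁻¹ * y, hg1.2.1, ?_⟩⟩
          · simpa using hg2.1.1
          · simpa using hg2.1.2
          · simpa using hp
          · simpa using hg2.2
        exact fun i j p hp => ha1 i k p (hsub p (hb1 l j p hp))
    · intro g hg i
      rcases List.mem_append.1 hg with hg | hg
      · have := hl1.2 g (List.mem_of_mem_dropLast hg) i
        exact ⟨this.1, fun b hb' => this.2 b (by simp at hb'; simp [hb'])⟩
      · have := hl2.2 g (List.mem_of_mem_tail hg) i
        exact ⟨fun b hb' => this.1 b (by simp at hb'; simp [hb']), this.2⟩
  have := hch.length_le_count hb (by simp) (by simp)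
  rw [List.length_append, List.length_dropLast, List.length_tail] at this
  omega

/-- Split each of the six counts at the third point. The split terms cancel, and each count differs
from its split by at most 1 one way and 2 the other: `9 = 3 * 1 + 3 * 2`. -/
theorem abs_height_cocycle_le (x y z : G) :
    |height P x y + height P y z - height P x z| ≤ 9 := by
  have a1 := count_le hb x y z
  have a2 := count_le hb y x z
  have a3 := count_le hb y z x
  have a4 := count_le hb z y x
  have a5 := count_le hb x z y
  have a6 := count_le hb z x y
  have b1 := le_count hb hS x y z
  have b2 := le_count hb hS y x z
  have b3 := le_count hb hS y z x
  have b4 := le_count hb hS z y x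
  have b5 := le_count hb hS x z y
  have b6 := le_count hb hS z x y
  rw [Set.pair_comm z x] at *
  rw [Set.pair_comm z y] at *
  rw [Set.pair_comm y x] at *
  rw [height, height, height, abs_le]
  constructor <;> omega

theorem abs_height_prod_le (ts : List G) (hts : ∀ t ∈ ts, t * t = 1) :
    |height P 1 ts.prod| ≤ 9 * ts.length := by
  induction ts with
  | nil =>
    rw [List.prod_nil, height_one_of_mul_self hb (mul_one 1)]
    simp
  | cons t ts ih =>
    have h1 := ih fun t ht => hts t (by simp [ht])
    have h2 := abs_height_cocycle_le hb hS 1 t (t * ts.prod)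
    have h3 := height_one_of_mul_self hb (hts t (by simp))
    have h4 := height_mul_left hb t 1 ts.prod
    rw [mul_one] at h4
    rw [h3, h4] at h2
    rw [List.prod_cons, List.length_cons]
    rw [abs_le] at *
    push_cast
    constructor <;> linarith

/-- If long powers of `w` cross many translates of the pattern, and none in the opposite direction,
then a factorization of a power of `w` into involutions is long. -/
theorem exponent_le_of_prod_eq_pow [Nonempty ι] {w : G} {N : ℕ} (hN : 0 < N)
    (hw : ∀ k, N ≤ k → Precedes P 1 (w ^ k))
    (hneg : ∀ k i, (w ^ k)⁻¹ ∉ P i) (hpos : ∀ k i, N ≤ k → w ^ k ∈ P i)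
    (hR : ∀ (k : ℕ) (g : G), ∃ i, ¬ (g⁻¹ * w ^ k ∉ P i ∧ g⁻¹ ∈ P i))
    {k : ℕ} {ts : List G} (hts : ∀ t ∈ ts, t * t = 1) (hprod : ts.prod = w ^ k) :
    k / N ≤ 9 * ts.length := by
  have h1 := abs_height_prod_le hb hS ts hts
  have h2 : count P {w ^ k} {1} = 0 := by
    obtain ⟨l, hl, he⟩ := exists_isChain_length_eq_count hb (Set.singleton_nonempty (w ^ k))
      (Set.singleton_nonempty 1)
    rw [← he]
    match l with
    | [] => rfl
    | g :: _ =>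
      obtain ⟨i, hi⟩ := hR k g
      have := hl.2 g (by simp) i
      simp only [Set.mem_singleton_iff, forall_eq, mul_one] at this
      exact absurd this hi
  have h3 : k / N ≤ count P {1} {w ^ k} := by
    have hch : IsChain P {1} {w ^ k} ((List.range (k / N)).map fun a => w ^ (a * N)) := by
      constructor
      · rw [List.pairwise_map]
        refine List.pairwise_lt_range.imp ?_
        intro a b hab
        have := (hw ((b - a) * N) (Nat.le_mul_of_pos_left N (by omega))).mul_left (w ^ (a * N))
        rwa [mul_one, ← pow_add, ← add_mul, Nat.add_sub_cancel' hab.le] at this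
      · intro g hg i
        obtain ⟨a, ha, rfl⟩ := List.mem_map.1 hg
        rw [List.mem_range, ← Nat.add_one_le_iff, Nat.le_div_iff_mul_le hN, add_mul, one_mul] at ha
        simp only [Set.mem_singleton_iff, forall_eq, mul_one]
        refine ⟨hneg _ i, ?_⟩
        have hak : a * N + (k - a * N) = k := by omega
        rw [← hak, pow_add, inv_mul_cancel_left]
        exact hpos _ i (by omega)
    simpa using hch.length_le_count hb (by simp) (by simp)
  rw [hprod, height, h2, abs_le] at h1
  omega

end CountingPattern

/-! ### The axis of a Coxeter element -/

namespace CoxeterSystem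

variable {B W : Type*} [Group W] {M : CoxeterMatrix B} (cs : CoxeterSystem M W) {n : ℕ}

/-- The product of the first `k` letters of the periodic word `E 0, E 1, …`. -/
def prefixProd (E : ZMod n ≃ B) : ℕ → W
  | 0 => 1
  | k + 1 => prefixProd E k * cs.simple (E k)

theorem prefixProd_succ_inv (E : ZMod n ≃ B) (k : ℕ) :
    (cs.prefixProd E (k + 1))⁻¹ = cs.simple (E k) * (cs.prefixProd E k)⁻¹ := by
  rw [prefixProd, mul_inv_rev, inv_simple]

theorem prefixProd_inv_eq (E : ZMod n ≃ B) (k : ℕ) :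
    (cs.prefixProd E k)⁻¹ = cs.simple (E k) * (cs.prefixProd E (k + 1))⁻¹ := by
  rw [prefixProd_succ_inv, simple_mul_simple_cancel_left]

theorem prefixProd_add_period (E : ZMod n ≃ B) (k : ℕ) :
    cs.prefixProd E (n + k) = cs.prefixProd E n * cs.prefixProd E k := by
  induction k with
  | zero => simp [prefixProd]
  | succ k ih => simp [prefixProd, ih, mul_assoc]

theorem prefixProd_mul_period (E : ZMod n ≃ B) (q k : ℕ) :
    cs.prefixProd E (q * n + k) = cs.prefixProd E n ^ q * cs.prefixProd E k := by
  induction q with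
  | zero => simp
  | succ q ih =>
    rw [show (q + 1) * n + k = n + (q * n + k) by ring, prefixProd_add_period, ih, pow_succ',
      mul_assoc]

theorem prefixProd_period_pow (E : ZMod n ≃ B) (q : ℕ) :
    cs.prefixProd E (q * n) = cs.prefixProd E n ^ q := by
  simpa [prefixProd] using cs.prefixProd_mul_period E q 0

theorem letter_ne (E : ZMod n ≃ B) (x : ZMod n) {j : ℕ} (hj0 : 0 < j) (hj : j < n) :
    E (x + j) ≠ E x := by
  intro h
  have h1 : ((j : ℕ) : ZMod n) = 0 := by simpa using E.injective h
  rw [ZMod.natCast_eq_zero_iff] at h1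
  exact absurd (Nat.le_of_dvd hj0 h1) (by omega)

theorem letter_add_ne_letter_add (E : ZMod n ≃ B) (x : ZMod n) {i j : ℕ} (hij : i < j)
    (hj : j < i + n) : E (x + j) ≠ E (x + i) := by
  have := letter_ne E (x + i) (j := j - i) (by omega) (by omega)
  rwa [add_assoc, ← Nat.cast_add, Nat.add_sub_cancel' hij.le] at this

/-- The coefficients of `v` are nonnegative and nondecreasing along `E x, …, E (x + n - 1)`. -/
def IsCoeffMonotone (E : ZMod n ≃ B) (x : ZMod n) (v : B → ℝ) : Prop :=
  0 ≤ v (E x) ∧ ∀ i j : ℕ, i ≤ j → j < n → v (E (x + i)) ≤ v (E (x + j))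

theorem IsCoeffMonotone.nonneg [NeZero n] {E : ZMod n ≃ B} {x : ZMod n} {v : B → ℝ}
    (h : IsCoeffMonotone E x v) : 0 ≤ v := by
  intro b
  have h1 := h.2 0 (E.symm b - x).val (Nat.zero_le _) (ZMod.val_lt _)
  simp only [Nat.cast_zero, add_zero, ZMod.natCast_val, ZMod.cast_id', id_eq, add_sub_cancel,
    Equiv.apply_symm_apply] at h1
  exact h.1.trans h1

theorem isCoeffMonotone_single [DecidableEq B] (E : ZMod n ≃ B) (x : ZMod n) :
    IsCoeffMonotone E (x + 1) (Pi.single (E x) 1) := by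
  refine ⟨?_, fun i j hij hj => ?_⟩
  · rw [Pi.single_apply]
    split_ifs <;> norm_num
  · rcases lt_or_ge (i + 1) n with hi | hi
    · have := letter_ne E x (Nat.succ_pos i) hi
      rw [Pi.single_apply, if_neg (by rw [add_assoc, add_comm (1 : ZMod n)]; exact_mod_cast this),
        Pi.single_apply]
      split_ifs <;> norm_num
    · rw [show i = j by omega]

variable [Fintype B] [DecidableEq B] [M.IsLarge]

/-- Reflecting changes only the smallest coefficient, `v (E x)`. As all cosines are at least `1/2`,
its new value is at least `-v (E x)` plus the second and the last coefficient, hence at least the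
last one; it becomes the new largest in the rotated order. -/
theorem IsCoeffMonotone.simple (hn : 3 ≤ n) {E : ZMod n ≃ B} {x : ZMod n} {v : B → ℝ}
    (h : IsCoeffMonotone E x v) :
    IsCoeffMonotone E (x + 1) (cs.geomRep (cs.simple (E x)) v) := by
  have : NeZero n := ⟨by omega⟩
  have h0 := h.nonneg
  have hother : ∀ b, b ≠ E x → cs.geomRep (cs.simple (E x)) v b = v b := by
    intro b hb
    rw [geomRep_simple_apply]
    simp [hb]
  have hlast : v (E (x + (n - 1 : ℕ))) ≤ cs.geomRep (cs.simple (E x)) v (E x) := by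
    have h1 : v (E (x + (n - 1 : ℕ))) + v (E (x + 1)) ≤
        ∑ j ∈ Finset.univ.erase (E x), 2 * (M.cosine (E x) j * v j) := by
      have hne : E (x + (n - 1 : ℕ)) ≠ E (x + 1) := by
        have := letter_ne E (x + 1) (j := n - 2) (by omega) (by omega)
        rw [add_assoc, add_comm (1 : ZMod n)] at this
        rw [show n - 1 = n - 2 + 1 by omega]
        exact_mod_cast this
      rw [← Finset.sum_pair hne (f := v)]
      have hsub : ({E (x + (n - 1 : ℕ)), E (x + 1)} : Finset B) ⊆ Finset.univ.erase (E x) := by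
        intro b hb
        rw [Finset.mem_insert, Finset.mem_singleton] at hb
        rw [Finset.mem_erase]
        refine ⟨?_, Finset.mem_univ _⟩
        rcases hb with rfl | rfl
        · exact letter_ne E x (by omega) (by omega)
        · simpa using letter_ne E x (j := 1) (by omega) (by omega)
      refine (Finset.sum_le_sum_of_subset_of_nonneg hsub fun b _ _ => h0 b).trans ?_
      refine Finset.sum_le_sum fun b hb => ?_
      have := M.half_le_cosine (Finset.ne_of_mem_erase hb).symm
      have := h0 b
      simp only [Pi.zero_apply] at this
      nlinarith
    have h2 := h.2 0 1 (by omega) (by omega)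
    rw [Nat.cast_zero, add_zero, Nat.cast_one] at h2
    rw [← Finset.mul_sum] at h1
    rw [geomRep_simple_apply, M.cosForm_single_left]
    simp only [Pi.sub_apply, Pi.smul_apply, Pi.single_eq_same, smul_eq_mul, mul_one]
    linarith
  refine ⟨?_, fun i j hij hj => ?_⟩
  · rw [hother _ (by simpa using letter_ne E x (j := 1) (by omega) (by omega))]
    exact h0 _
  · have e : ∀ k : ℕ, x + 1 + (k : ZMod n) = x + (k + 1 : ℕ) := by
      intro k; push_cast; ring
    rw [e, e]
    rcases hij.eq_or_lt with rfl | hij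
    · exact le_rfl
    rw [hother _ (letter_ne E x (by omega) (by omega))]
    rcases lt_or_ge (j + 1) n with hj' | hj'
    · rw [hother _ (letter_ne E x (by omega) hj')]
      exact h.2 _ _ (by omega) hj'
    · rw [show j + 1 = n by omega, ZMod.natCast_self, add_zero]
      exact (h.2 (i + 1) (n - 1) (by omega) (by omega)).trans hlast

/-- The positive root of the `k`-th wall crossed by the periodic word. -/
noncomputable def axisRoot (E : ZMod n ≃ B) (k : ℕ) : B → ℝ :=
  cs.geomRep (cs.prefixProd E k) (Pi.single (E k) 1)

theorem isRoot_axisRoot (E : ZMod n ≃ B) (k : ℕ) : cs.IsRoot (cs.axisRoot E k) := ⟨_, _, rfl⟩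

theorem geomRep_prefixProd_inv_axisRoot (E : ZMod n ≃ B) (k : ℕ) :
    cs.geomRep (cs.prefixProd E k)⁻¹ (cs.axisRoot E k) = Pi.single (E k) 1 :=
  cs.geomRep_inv_apply_self _ _

theorem geomRep_pow_axisRoot (E : ZMod n ≃ B) (q k : ℕ) :
    cs.geomRep (cs.prefixProd E n ^ q) (cs.axisRoot E k) = cs.axisRoot E (q * n + k) := by
  rw [axisRoot, axisRoot, prefixProd_mul_period, geomRep_mul_apply]
  simp

theorem axisRoot_nonpos (hn : 3 ≤ n) (E : ZMod n ≃ B) {i m : ℕ} (h : i < m) :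
    cs.geomRep (cs.prefixProd E m)⁻¹ (cs.axisRoot E i) ≤ 0 := by
  have : NeZero n := ⟨by omega⟩
  suffices h : IsCoeffMonotone E m (-cs.geomRep (cs.prefixProd E m)⁻¹ (cs.axisRoot E i)) from
    neg_nonneg.1 h.nonneg
  induction m, h using Nat.le_induction with
  | base =>
    rw [prefixProd_succ_inv, geomRep_mul_apply, geomRep_prefixProd_inv_axisRoot,
      geomRep_simple_self, neg_neg, Nat.succ_eq_add_one, Nat.cast_add, Nat.cast_one]
    exact isCoeffMonotone_single E i
  | succ m _ ih =>
    rw [prefixProd_succ_inv, geomRep_mul_apply, ← map_neg, Nat.cast_add, Nat.cast_one]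
    exact ih.simple cs hn

theorem axisRoot_nonneg (hn : 3 ≤ n) (E : ZMod n ≃ B) {i m : ℕ} (h : m ≤ i) :
    0 ≤ cs.geomRep (cs.prefixProd E m)⁻¹ (cs.axisRoot E i) := by
  have : NeZero n := ⟨by omega⟩
  -- Walking backwards along the axis reads the letters in reverse cyclic order.
  obtain ⟨F, hF⟩ : ∃ F : ZMod n ≃ B, ∀ x, E x = F (-x) :=
    ⟨(Equiv.neg _).trans E, fun x => by simp⟩
  suffices h : IsCoeffMonotone F (-m + 1)
      (cs.geomRep (cs.prefixProd E m)⁻¹ (cs.axisRoot E i)) from h.nonneg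
  induction h using Nat.decreasingInduction with
  | self =>
    rw [geomRep_prefixProd_inv_axisRoot, hF]
    exact isCoeffMonotone_single F _
  | of_succ m _ ih =>
    rw [prefixProd_inv_eq, geomRep_mul_apply, hF]
    rw [Nat.cast_add, Nat.cast_one, neg_add, neg_add_cancel_right] at ih
    exact ih.simple cs hn

theorem axisRoot_injective (hn : 3 ≤ n) (E : ZMod n ≃ B) :
    Function.Injective (cs.axisRoot E) := by
  intro i j h
  by_contra hne
  wlog hij : i < j generalizing i j
  · exact this h.symm (Ne.symm hne) (by omega)
  have h1 := cs.axisRoot_nonpos hn E hij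
  have h2 := cs.axisRoot_nonneg hn E (le_refl j)
  rw [← h] at h2
  exact ((cs.isRoot_axisRoot E i).geomRep _).not_nonneg.2 h1 h2

/-- A wall separating two chambers of the axis is a wall of the axis. -/
theorem exists_axisRoot_eq (E : ZMod n ≃ B) {β : B → ℝ} (hβ : cs.IsRoot β) (h0 : 0 ≤ β) {m : ℕ}
    (hm : cs.geomRep (cs.prefixProd E m)⁻¹ β ≤ 0) : ∃ b < m, β = cs.axisRoot E b := by
  induction m with
  | zero =>
    rw [prefixProd, inv_one, geomRep_one_apply] at hm
    exact absurd h0 (hβ.not_nonneg.2 hm)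
  | succ m ih =>
    by_cases h : cs.geomRep (cs.prefixProd E m)⁻¹ β ≤ 0
    · obtain ⟨b, hb, h⟩ := ih h
      exact ⟨b, by omega, h⟩
    · refine ⟨m, by omega, ?_⟩
      rw [prefixProd_succ_inv, geomRep_mul_apply] at hm
      rw [axisRoot, ← (hβ.geomRep _).eq_single_of_simple_nonpos ((hβ.geomRep _).not_nonpos.1 h) hm,
        geomRep_apply_inv_self]

/-- The chamber `prefixProd E (i + 1)` lies between the two walls. With `g` beyond the second but
not the first, it would give opposite quadrants for the roots `-axisRoot E i` and `axisRoot E j`,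
whose form is at most `-1`. -/
theorem axisRoot_nested_of_cosForm (hn : 3 ≤ n) (E : ZMod n ≃ B) {i j : ℕ} (hij : i < j)
    (h : 1 ≤ M.cosForm (cs.axisRoot E i) (cs.axisRoot E j)) {g : W}
    (hg : cs.geomRep g⁻¹ (cs.axisRoot E j) ≤ 0) : cs.geomRep g⁻¹ (cs.axisRoot E i) ≤ 0 := by
  by_contra hc
  rw [((cs.isRoot_axisRoot E i).geomRep _).not_nonpos] at hc
  refine cs.not_separating_of_cosForm_le (cs.isRoot_axisRoot E i).neg (cs.isRoot_axisRoot E j)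
    ?_ (x := cs.prefixProd E (i + 1)) (y := g) ?_ ?_ ?_ hg
  · rw [map_neg, LinearMap.neg_apply]
    linarith
  · rw [map_neg, neg_nonneg]
    exact cs.axisRoot_nonpos hn E (by omega)
  · exact cs.axisRoot_nonneg hn E (by omega)
  · rw [map_neg, neg_nonpos]
    exact hc

theorem cosForm_axisRoot_add_two (E : ZMod n ≃ B) (i : ℕ) :
    M.cosForm (cs.axisRoot E i) (cs.axisRoot E (i + 2)) =
      M.cosine (E i) (E (i + 2)) +
        2 * M.cosine (E (i + 1)) (E (i + 2)) * M.cosine (E i) (E (i + 1)) := by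
  simp only [axisRoot, prefixProd, cosForm_geomRep, geomRep_mul_apply]
  push_cast
  rw [← inv_inv (cs.simple (E i)), ← cosForm_geomRep_left, inv_simple, geomRep_simple_self,
    geomRep_simple_single]
  simp only [map_add, map_neg, LinearMap.neg_apply, map_smul, M.cosForm_single, smul_eq_mul]
  ring

theorem cosForm_axisRoot_add_three (E : ZMod n ≃ B) (i : ℕ) :
    M.cosForm (cs.axisRoot E i) (cs.axisRoot E (i + 3)) =
      M.cosine (E i) (E (i + 3)) +
        2 * M.cosine (E (i + 1)) (E (i + 3)) * M.cosine (E i) (E (i + 1)) +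
        2 * M.cosine (E (i + 2)) (E (i + 3)) * (M.cosine (E i) (E (i + 2)) +
          2 * M.cosine (E (i + 1)) (E (i + 2)) * M.cosine (E i) (E (i + 1))) := by
  simp only [axisRoot, prefixProd, cosForm_geomRep, geomRep_mul_apply]
  push_cast
  rw [← inv_inv (cs.simple (E i)), ← cosForm_geomRep_left, inv_simple, geomRep_simple_self,
    geomRep_simple_single, map_add, map_smul, geomRep_simple_single, geomRep_simple_single]
  simp only [map_add, map_neg, LinearMap.neg_apply, map_smul, M.cosForm_single, smul_eq_mul]
  ring

theorem exists_not_nested_succ (hn : 3 ≤ n) (E : ZMod n ≃ B) (i : ℕ) :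
    ∃ g : W, cs.geomRep g⁻¹ (cs.axisRoot E (i + 1)) ≤ 0 ∧
      0 ≤ cs.geomRep g⁻¹ (cs.axisRoot E i) := by
  have hne : E (i : ZMod n) ≠ E (i + 1) := by
    simpa using (letter_ne E (i : ZMod n) (j := 1) (by omega) (by omega)).symm
  have h3 := CoxeterMatrix.IsLarge.three_le (M := M) hne
  obtain ⟨m, hm⟩ := Nat.exists_eq_succ_of_ne_zero (M.ne_zero_of_isLarge (E i) (E (i + 1)))
  -- From the chamber before wall `i`, go round the intersection of the two walls the other way,
  -- stopping just short of wall `i`: all other walls through the intersection, including wall `i +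
  -- 1`, are then crossed.
  refine ⟨cs.prefixProd E i * (cs.wordProd (alternatingWord (E i) (E (i + 1)) m))⁻¹, ?_, ?_⟩
  · rw [mul_inv_rev, inv_inv, axisRoot, prefixProd, geomRep_mul_apply, geomRep_mul_apply,
      geomRep_inv_apply_self, ← geomRep_mul_apply, ← wordProd_concat, ← alternatingWord_succ]
    push_cast
    rw [cs.geomRep_alternatingWord hne.symm, M.symmetric, hm]
    have h0 : ((m.succ : ℕ) : ℝ) ≠ 0 := by positivity
    have hpos : 0 < Real.sin (Real.pi / (m.succ : ℕ)) := by
      have h3' : (3 : ℝ) ≤ (m.succ : ℕ) := by rw [← hm]; exact_mod_cast h3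
      apply Real.sin_pos_of_pos_of_lt_pi
      · positivity
      · exact div_lt_self Real.pi_pos (by linarith)
    rw [show ((m + 1 : ℕ) + 1 : ℝ) * (Real.pi / (m.succ : ℕ)) =
      Real.pi / (m.succ : ℕ) + Real.pi by
        rw [add_mul, one_mul, mul_div_cancel₀ _ h0, add_comm], Real.sin_add_pi,
      mul_div_cancel₀ _ h0, Real.sin_pi, zero_div, zero_smul, add_zero, neg_div, div_self hpos.ne',
      neg_smul, one_smul, neg_nonpos, Pi.single_nonneg]
    exact zero_le_one
  · rw [mul_inv_rev, inv_inv, geomRep_mul_apply, geomRep_prefixProd_inv_axisRoot]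
    obtain ⟨a, b, ha, hb, h⟩ := cs.geomRep_alternatingWord_nonneg hne (q := m) (by omega)
    rw [h]
    exact add_nonneg (smul_nonneg ha (Pi.single_nonneg.2 zero_le_one))
      (smul_nonneg hb (Pi.single_nonneg.2 zero_le_one))

end CoxeterSystem

/-! ### A recurrence for the coefficients of a wall seen along the axis. -/

/-- A nonnegative sequence satisfying a recurrence inequality that forces exponential growth cannot
grow slowly for a long time. -/
theorem not_slow_of_recurrence {n L : ℕ} {κ : ℝ} (hn : 3 ≤ n) (hκ : 3 ≤ κ * (n - 1))
    (hL : n * (32 * n + 3) < L) (a : ℕ → ℝ) (h0 : ∀ k < L, 0 ≤ a k)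
    (hslow : ∀ k, k + n < L → |a (k + n) - a k| ≤ 2)
    (hrec : ∀ k, k + n < L →
      κ * (∑ j ∈ Finset.range n, a (k + j) - a k) ≤ a (k + n) + a k)
    (hone : ∀ k, k + n < L → 1 ≤ ∑ j ∈ Finset.range n, a (k + j)) : False := by
  have hn' : (3 : ℝ) ≤ n := by exact_mod_cast hn
  have hκ0 : 0 < κ := by
    by_contra h
    nlinarith
  obtain ⟨S, hS⟩ : ∃ S : ℕ → ℝ, ∀ k, S k = ∑ j ∈ Finset.range n, a (k + j) := ⟨_, fun _ => rfl⟩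
  simp only [← hS] at hrec hone
  have hSsucc : ∀ k, S (k + 1) = S k + (a (k + n) - a k) := by
    intro k
    have h1 := Finset.sum_range_succ (fun j => a (k + j)) n
    rw [Finset.sum_range_succ'] at h1
    simp only [add_zero, ← add_assoc] at h1
    rw [hS, hS]
    simp only [add_right_comm k 1]
    linarith
  have hlip : ∀ i k, k + i + n < L + 1 → |S (k + i) - S k| ≤ 2 * i := by
    intro i
    induction i with
    | zero => intro k _; simp
    | succ i ih =>
      intro k hk
      have h1 := ih k (by omega)
      have h2 := hslow (k + i) (by omega)
      rw [← add_assoc, hSsucc]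
      rw [abs_le] at *
      push_cast
      constructor <;> linarith
  -- Sum the recurrence over one period: as the window sum `S` moves by at most 2 per step, `3 (S k
  -- - 2n) ≤ 2 S k + 2n`.
  have hblock : ∀ k, k + 2 * n < L → S k ≤ 8 * n := by
    intro k hk
    by_contra hlt
    push Not at hlt
    have h1 := Finset.sum_le_sum (s := Finset.range n) (f := fun i => κ * (S (k + i) - a (k + i)))
      (g := fun i => a (k + n + i) + a (k + i)) fun i hi => by
        rw [Finset.mem_range] at hi
        have := hrec (k + i) (by omega)
        rwa [add_right_comm] at this
    rw [← Finset.mul_sum, Finset.sum_sub_distrib, Finset.sum_add_distrib, ← hS, ← hS] at h1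
    have h2 : S k + (n - 1) * (S k - 2 * n) ≤ ∑ i ∈ Finset.range n, S (k + i) := by
      obtain ⟨m, rfl⟩ := Nat.exists_eq_succ_of_ne_zero (by omega : n ≠ 0)
      rw [Finset.sum_range_succ', add_zero, add_comm]
      gcongr
      have h3 : ∀ i ∈ Finset.range m, S k - 2 * (m.succ : ℕ) ≤ S (k + (i + 1)) := by
        intro i hi
        rw [Finset.mem_range] at hi
        have h4 := (abs_le.1 (hlip (i + 1) k (by omega))).1
        have h5 : ((i + 1 : ℕ) : ℝ) ≤ (m.succ : ℕ) := by exact_mod_cast (by omega)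
        linarith
      have h6 := Finset.sum_le_sum h3
      rw [Finset.sum_const, Finset.card_range, nsmul_eq_mul] at h6
      push_cast at h6 ⊢
      linarith
    have h4 := (abs_le.1 (hlip n k (by omega))).2
    have h5 : κ * ((n - 1) * (S k - 2 * n)) ≤ κ * (∑ i ∈ Finset.range n, S (k + i) - S k) := by
      gcongr
      linarith
    have h6 : 3 * (S k - 2 * n) ≤ κ * (n - 1) * (S k - 2 * n) := by
      gcongr
      linarith
    linarith
  -- Summing over `N` terms with total `A` gives `3 (A - S 0) ≤ 2 A + S N - S 0`, so `A ≤ 2 S 0 + S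
  -- N ≤ 24 n`. But `N` consists of `32 n + 1` windows of sum at least 1.
  obtain ⟨N, hN⟩ : ∃ N, N = n * (32 * n + 1) := ⟨_, rfl⟩
  have hNL : N + 2 * n < L := by rw [hN]; linarith
  have hshift : ∀ j ≤ n, ∑ k ∈ Finset.range N, a (k + j) =
      ∑ k ∈ Finset.range N, a k + ∑ k ∈ Finset.range j, a (N + k) - ∑ k ∈ Finset.range j, a k := by
    intro j _
    have h1 := Finset.sum_range_add a N j
    have h2 := Finset.sum_range_add a j N
    rw [add_comm j N] at h2
    simp only [add_comm j] at h2
    linarith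
  have hA : (32 * n + 1 : ℝ) ≤ ∑ k ∈ Finset.range N, a k := by
    have h1 : ∀ q ≤ 32 * n + 1, (q : ℝ) ≤ ∑ k ∈ Finset.range (n * q), a k := by
      intro q hq
      induction q with
      | zero => simp
      | succ q ih =>
        rw [mul_add, mul_one, Finset.sum_range_add, ← hS]
        have h2 := ih (by omega)
        have h3 : n * (q + 1) ≤ n * (32 * n + 1) := Nat.mul_le_mul_left n hq
        have h4 := hone (n * q) (by rw [mul_add, mul_one, ← hN] at h3; omega)
        push_cast
        linarith
    rw [hN]
    exact_mod_cast h1 _ le_rfl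
  have hsum := Finset.sum_le_sum (s := Finset.range N) (f := fun k => κ * (S k - a k))
    (g := fun k => a (k + n) + a k) fun k hk => by
      rw [Finset.mem_range] at hk
      exact hrec k (by omega)
  rw [← Finset.mul_sum, Finset.sum_sub_distrib, Finset.sum_add_distrib, hshift n le_rfl] at hsum
  have hS0 := hblock 0 (by omega)
  have hSN := hblock N hNL
  have h0S : S 0 = ∑ k ∈ Finset.range n, a k := by simp [hS]
  have hdouble : ∑ k ∈ Finset.range N, a k + (n - 1) * (∑ k ∈ Finset.range N, a k - S 0) ≤
      ∑ k ∈ Finset.range N, S k := by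
    simp only [hS]
    rw [Finset.sum_comm]
    simp only [zero_add]
    obtain ⟨m, rfl⟩ := Nat.exists_eq_succ_of_ne_zero (by omega : n ≠ 0)
    rw [Finset.sum_range_succ' (fun j => ∑ k ∈ Finset.range N, a (k + j)) m]
    simp only [add_zero]
    rw [add_comm]
    gcongr
    have h3 : ∀ j ∈ Finset.range m, ∑ k ∈ Finset.range N, a k -
        ∑ k ∈ Finset.range m.succ, a k ≤ ∑ k ∈ Finset.range N, a (k + (j + 1)) := by
      intro j hj
      rw [Finset.mem_range] at hj
      rw [hshift (j + 1) (by omega)]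
      have h4 : 0 ≤ ∑ k ∈ Finset.range (j + 1), a (N + k) := by
        refine Finset.sum_nonneg fun k hk => h0 _ ?_
        rw [Finset.mem_range] at hk
        omega
      have h5 : ∑ k ∈ Finset.range (j + 1), a k ≤ ∑ k ∈ Finset.range m.succ, a k := by
        refine Finset.sum_le_sum_of_subset_of_nonneg (Finset.range_subset_range.2 (by omega)) ?_
        intro k hk _
        rw [Finset.mem_range] at hk
        exact h0 k (by omega)
      linarith
    have h6 := Finset.sum_le_sum h3
    rw [Finset.sum_const, Finset.card_range, nsmul_eq_mul] at h6
    push_cast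
    linarith
  rw [← hS, ← h0S] at hsum
  have h5 := mul_le_mul_of_nonneg_left hdouble hκ0.le
  have h6 : 3 * (∑ k ∈ Finset.range N, a k - S 0) ≤
      κ * (n - 1) * (∑ k ∈ Finset.range N, a k - S 0) := by
    gcongr
    linarith
  have h7 := hone 0 (by omega)
  linarith

/-! ### Nesting of the walls of the axis. -/

namespace CoxeterSystem

variable {B W : Type*} [Fintype B] [DecidableEq B] [Group W] {M : CoxeterMatrix B} [M.IsLarge]
  (cs : CoxeterSystem M W) {n : ℕ}

/-- At distances 2 and 3 the form is at least 1 by direct computation, and larger distances are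
reached in steps of 2. Distance 3 with `n = 3` is delicate: the letter repeats, contributing `-1`,
and cosines `1/2` would not suffice, whereas `κ ≥ 3/2` gives `3/4`. -/
theorem axisRoot_nested (hn : 3 ≤ n) {κ : ℝ} (hκ : 3 ≤ κ * (n - 1))
    (hM : ∀ i j, i ≠ j → κ ≤ 2 * M.cosine i j) (E : ZMod n ≃ B) {i j : ℕ} (hij : i + 2 ≤ j) {g : W}
    (hg : cs.geomRep g⁻¹ (cs.axisRoot E j) ≤ 0) : cs.geomRep g⁻¹ (cs.axisRoot E i) ≤ 0 := by
  induction hd : j - i using Nat.strong_induction_on generalizing i with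
  | _ d ih =>
  have h01 : E (i : ZMod n) ≠ E (i + 1) := by
    simpa using (letter_add_ne_letter_add E (i : ZMod n) (i := 0) (j := 1)
      (by omega) (by omega)).symm
  have h02 : E (i : ZMod n) ≠ E (i + 2) := by
    simpa using (letter_add_ne_letter_add E (i : ZMod n) (i := 0) (j := 2)
      (by omega) (by omega)).symm
  have h12 : E ((i : ZMod n) + 1) ≠ E (i + 2) := by
    simpa using (letter_add_ne_letter_add E (i : ZMod n) (i := 1) (j := 2)
      (by omega) (by omega)).symm
  have h13 : E ((i : ZMod n) + 1) ≠ E (i + 3) := by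
    simpa using (letter_add_ne_letter_add E (i : ZMod n) (i := 1) (j := 3)
      (by omega) (by omega)).symm
  have h23 : E ((i : ZMod n) + 2) ≠ E (i + 3) := by
    simpa using (letter_add_ne_letter_add E (i : ZMod n) (i := 2) (j := 3)
      (by omega) (by omega)).symm
  have c01 := M.half_le_cosine h01
  have c02 := M.half_le_cosine h02
  have c12 := M.half_le_cosine h12
  have c13 := M.half_le_cosine h13
  have c23 := M.half_le_cosine h23
  have htwo : 1 ≤ M.cosForm (cs.axisRoot E i) (cs.axisRoot E (i + 2)) := by
    rw [cosForm_axisRoot_add_two]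
    nlinarith
  rcases (by omega : j = i + 2 ∨ j = i + 3 ∨ i + 4 ≤ j) with rfl | rfl | hj
  · exact cs.axisRoot_nested_of_cosForm hn E (by omega) htwo hg
  · refine cs.axisRoot_nested_of_cosForm hn E (by omega) ?_ hg
    rw [cosForm_axisRoot_add_three]
    rcases (by omega : n = 3 ∨ 4 ≤ n) with rfl | hn4
    · have hκ' : 3 / 2 ≤ κ := by
        norm_num at hκ
        linarith
      have h3 : (3 : ZMod 3) = 0 := by decide
      have k01 := hM _ _ h01
      have k02 := hM _ _ h02
      have k12 := hM _ _ h12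
      rw [h3, add_zero] at *
      rw [M.cosine_self, M.cosine_comm _ (E (i : ZMod 3)), M.cosine_comm _ (E (i : ZMod 3))]
      generalize M.cosine (E (i : ZMod 3)) (E (i + 1)) = x at *
      generalize M.cosine (E (i : ZMod 3)) (E (i + 2)) = y at *
      generalize M.cosine (E ((i : ZMod 3) + 1)) (E (i + 2)) = z at *
      have hx : 3 / 4 ≤ x := by linarith
      have hy : 3 / 4 ≤ y := by linarith
      have hz : 3 / 4 ≤ z := by linarith
      have h1 : 9 / 16 ≤ x * x := by nlinarith
      have h2 : 9 / 16 ≤ y * y := by nlinarith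
      have h3 : 9 / 16 ≤ x * z := by nlinarith
      have h4 : 27 / 64 ≤ y * (x * z) := by nlinarith
      linarith
    · have h03 : E (i : ZMod n) ≠ E (i + 3) := by
        simpa using (letter_add_ne_letter_add E (i : ZMod n) (i := 0) (j := 3)
          (by omega) (by omega)).symm
      have c03 := M.half_le_cosine h03
      have h1 : 0 ≤ M.cosine (E (i + 1)) (E (i + 3)) * M.cosine (E i) (E (i + 1)) := by positivity
      have h2 : 0 ≤ M.cosine (E (i + 1)) (E (i + 2)) * M.cosine (E i) (E (i + 1)) := by positivity
      nlinarith
  · exact cs.axisRoot_nested_of_cosForm hn E (by omega) htwo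
      (ih (j - (i + 2)) (by omega) (by omega) rfl)

end CoxeterSystem

theorem sum_range_letter {B : Type*} [Fintype B] {n : ℕ} [NeZero n] (E : ZMod n ≃ B) (x : ZMod n)
    (f : B → ℝ) : ∑ j ∈ Finset.range n, f (E (x + j)) = ∑ b, f b := by
  refine Finset.sum_bij' (fun j _ => E (x + j)) (fun b _ => (E.symm b - x).val)
    (fun _ _ => Finset.mem_univ _) (fun b _ => Finset.mem_range.2 (ZMod.val_lt _)) ?_ ?_ ?_
  · intro j hj
    rw [Finset.mem_range] at hj
    simp [ZMod.val_natCast, Nat.mod_eq_of_lt hj]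
  · intro b _
    simp
  · intro j _
    rfl

/-! ### Walls crossing the axis, and translates reversing it. -/

namespace CoxeterSystem

variable {B W : Type*} [Fintype B] [DecidableEq B] [Group W] {M : CoxeterMatrix B} [M.IsLarge]
  (cs : CoxeterSystem M W) {n : ℕ}

-- All entries of the Gram matrix are at most 1, so the norm 1 of `β` is at most the square of its
-- coefficient sum.
variable {cs} in
theorem IsRoot.one_le_sum {β : B → ℝ} (h : cs.IsRoot β) (hβ : 0 ≤ β) : 1 ≤ ∑ i, β i := by
  have h1 : M.cosForm β β ≤ (∑ i, β i) * ∑ i, β i := by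
    rw [M.cosForm_apply, Finset.sum_mul_sum]
    refine Finset.sum_le_sum fun i _ => Finset.sum_le_sum fun j _ => ?_
    have h1 := M.neg_one_le_cosine i j
    have h2 : 0 ≤ β i * β j := mul_nonneg (hβ i) (hβ j)
    nlinarith
  rw [h.cosForm_self] at h1
  have h2 := h.sum_pos hβ
  nlinarith

theorem geomRep_simple_apply_of_ne {i b : B} (h : b ≠ i) (v : B → ℝ) :
    cs.geomRep (cs.simple i) v b = v b := by
  rw [geomRep_simple_apply]
  simp [h]

theorem geomRep_prefixProd_inv_coeff (E : ZMod n ≃ B) (v : B → ℝ) (b : B) (m d : ℕ)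
    (h : ∀ t < d, E ((m + t : ℕ) : ZMod n) ≠ b) :
    cs.geomRep (cs.prefixProd E (m + d))⁻¹ v b = cs.geomRep (cs.prefixProd E m)⁻¹ v b := by
  induction d with
  | zero => rfl
  | succ d ih =>
    rw [← add_assoc, prefixProd_succ_inv, geomRep_mul_apply,
      geomRep_simple_apply_of_ne _ (h d (by omega)).symm, ih fun t ht => h t (by omega)]

/-- No wall crosses all walls of a long segment of the axis. -/
theorem not_forall_abs_cosForm_lt_one (hn : 3 ≤ n) {κ : ℝ} (hκ : 3 ≤ κ * (n - 1))
    (hM : ∀ i j, i ≠ j → κ ≤ 2 * M.cosine i j) (E : ZMod n ≃ B) {L : ℕ}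
    (hL : n * (32 * n + 3) < L) {γ : B → ℝ} (hγ : cs.IsRoot γ)
    (h : ∀ k < L, |M.cosForm γ (cs.axisRoot E k)| < 1) : False := by
  have : NeZero n := ⟨by omega⟩
  wlog h0 : 0 ≤ γ generalizing γ
  · refine this hγ.neg (fun k hk => ?_) (neg_nonneg.2 (hγ.not_nonneg.1 h0))
    rw [map_neg, LinearMap.neg_apply, abs_neg]
    exact h k hk
  obtain ⟨v, hv⟩ : ∃ v : ℕ → B → ℝ, ∀ k, v k = cs.geomRep (cs.prefixProd E k)⁻¹ γ :=
    ⟨_, fun _ => rfl⟩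
  have hroot : ∀ k, cs.IsRoot (v k) := fun k => by
    rw [hv]
    exact hγ.geomRep _
  have hsucc : ∀ k, v (k + 1) = cs.geomRep (cs.simple (E k)) (v k) := fun k => by
    rw [hv, hv, prefixProd_succ_inv, geomRep_mul_apply]
  have hform : ∀ k : ℕ, M.cosForm (Pi.single (E k) 1) (v k) = M.cosForm γ (cs.axisRoot E k) := by
    intro k
    rw [hv, axisRoot, M.cosForm_comm γ, cosForm_geomRep_left]
  -- At a first change of sign `γ` would be the axis root itself, with form 1.
  have hnonneg : ∀ k ≤ L, 0 ≤ v k := by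
    intro k hk
    induction k with
    | zero =>
      rw [hv, prefixProd, inv_one, geomRep_one_apply]
      exact h0
    | succ k ih =>
      by_contra hc
      rw [(hroot _).not_nonneg, hsucc] at hc
      have h1 := hform k
      rw [(hroot k).eq_single_of_simple_nonpos (ih (by omega)) hc, M.cosForm_single_self] at h1
      have h2 := h k (by omega)
      rw [← h1, abs_one] at h2
      exact lt_irrefl _ h2
  have hcoeff : ∀ k j, j < n → v (k + j) (E (k + j)) = v k (E (k + j)) := by
    intro k j hj
    rw [hv, hv]
    refine cs.geomRep_prefixProd_inv_coeff E γ _ k j fun t ht => ?_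
    rw [Nat.cast_add]
    exact (letter_add_ne_letter_add E (k : ZMod n) ht (by omega)).symm
  have hperiod : ∀ k : ℕ, v (k + n) (E ((k + n : ℕ) : ZMod n)) =
      v k (E k) - 2 * M.cosForm γ (cs.axisRoot E k) := by
    intro k
    have h1 : v (k + n) (E k) = v (k + 1) (E k) := by
      rw [hv, hv, show k + n = k + 1 + (n - 1) by omega]
      refine cs.geomRep_prefixProd_inv_coeff E γ _ (k + 1) (n - 1) fun t ht => ?_
      have := letter_ne E (k : ZMod n) (j := 1 + t) (by omega) (by omega)
      push_cast at this ⊢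
      rwa [← add_assoc] at this
    rw [Nat.cast_add, ZMod.natCast_self, add_zero, h1, hsucc, geomRep_simple_apply, hform]
    simp
  have hsum : ∀ k : ℕ, ∑ j ∈ Finset.range n, v (k + j) (E ((k + j : ℕ) : ZMod n)) =
      ∑ b, v k b := by
    intro k
    rw [← sum_range_letter E (k : ZMod n)]
    refine Finset.sum_congr rfl fun j hj => ?_
    rw [Nat.cast_add]
    exact hcoeff k j (Finset.mem_range.1 hj)
  -- The sequence records the coefficient about to be reflected at step `k`. It is next changed one
  -- period later, so a window of `n` terms lists all coefficients of `v k`.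
  refine not_slow_of_recurrence hn hκ hL (fun k => v k (E k)) (fun k hk => hnonneg k hk.le _)
    ?_ ?_ ?_
  · intro k hk
    have h1 := h k (by omega)
    simp only [hperiod]
    rw [abs_lt] at h1
    rw [abs_le]
    constructor <;> linarith
  · intro k hk
    simp only [hsum]
    rw [← Finset.add_sum_erase _ _ (Finset.mem_univ (E (k : ZMod n))), add_sub_cancel_left,
      hperiod, ← hform, M.cosForm_single_left]
    have h1 : ∑ b ∈ Finset.univ.erase (E (k : ZMod n)), κ * v k b ≤
        ∑ b ∈ Finset.univ.erase (E (k : ZMod n)), 2 * (M.cosine (E k) b * v k b) := by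
      refine Finset.sum_le_sum fun b hb => ?_
      have h2 := hM _ _ (Finset.ne_of_mem_erase hb).symm
      have h3 := hnonneg k (by omega) b
      simp only [Pi.zero_apply] at h3
      nlinarith
    rw [← Finset.mul_sum, ← Finset.mul_sum] at h1
    linarith
  · intro k hk
    simp only [hsum]
    exact (hroot k).one_le_sum (hnonneg k (by omega))

theorem geomRep_conj_of_single_eq {u : W} {i j : B}
    (h : cs.geomRep u (Pi.single i 1) = Pi.single j 1) (v : B → ℝ) :
    cs.geomRep (cs.simple j * u * cs.simple i) v = cs.geomRep u v := by
  rw [geomRep_mul_apply, geomRep_mul_apply, cs.geomRep_simple_apply i v, map_sub, map_smul, h,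
    map_sub, map_smul, geomRep_simple_self, geomRep_simple_apply, ← h, cosForm_geomRep]
  module

/-- No translate of a long segment of the axis runs along the axis in the opposite direction. -/
theorem not_axis_reversed (hn : 3 ≤ n) {κ : ℝ} (hκ : 3 ≤ κ * (n - 1))
    (hM : ∀ i j, i ≠ j → κ ≤ 2 * M.cosine i j) (E : ZMod n ≃ B) {L : ℕ} (hL : n + 2 ≤ L)
    (m : ℕ) (g : W)
    (h1 : ∀ i < L, cs.geomRep g (cs.axisRoot E i) ≤ 0)
    (h2 : ∀ i < L, 0 ≤ cs.geomRep ((cs.prefixProd E m)⁻¹ * g) (cs.axisRoot E i)) : False := by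
  have : NeZero n := ⟨by omega⟩
  -- The walls of the translated segment separate two chambers of the axis, so they are axis walls,
  -- with opposite orientation; `b` gives their positions.
  have hb : ∀ i, ∃ b, i < L → -cs.geomRep g (cs.axisRoot E i) = cs.axisRoot E b := by
    intro i
    by_cases hi : i < L
    · obtain ⟨b, -, hb⟩ := cs.exists_axisRoot_eq E ((cs.isRoot_axisRoot E i).geomRep g).neg
        (neg_nonneg.2 (h1 i hi)) (m := m) (by
          rw [map_neg, neg_nonpos, ← geomRep_mul_apply]
          exact h2 i hi)
      exact ⟨b, fun _ => hb⟩
    · exact ⟨0, fun h => absurd h hi⟩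
  choose b hb using hb
  have hact : ∀ x : W, ∀ i < L, cs.geomRep x⁻¹ (cs.axisRoot E (b i)) =
      -cs.geomRep (g⁻¹ * x)⁻¹ (cs.axisRoot E i) := by
    intro x i hi
    rw [← hb i hi, map_neg, mul_inv_rev, inv_inv, geomRep_mul_apply]
  have hroot : ∀ (x : W) (i : ℕ), cs.IsRoot (cs.geomRep x (cs.axisRoot E i)) := fun x i =>
    (cs.isRoot_axisRoot E i).geomRep x
  have htwo : ∀ i, i + 2 < L → b (i + 2) < b i := by
    intro i hi
    by_contra hle
    rcases (not_lt.1 hle).eq_or_lt with heq | hlt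
    · have h3 := hb i (by omega)
      rw [heq, ← hb (i + 2) hi, neg_inj] at h3
      have := cs.axisRoot_injective hn E ((cs.geomRep g).injective h3)
      omega
    · have h3 := cs.axisRoot_nonpos hn E (Nat.lt_succ_self (b i))
      have h4 := cs.axisRoot_nonneg hn E (Nat.succ_le_of_lt hlt)
      rw [hact _ i (by omega), neg_nonpos] at h3
      rw [hact _ (i + 2) hi, neg_nonneg] at h4
      exact (hroot _ _).not_nonneg.2 (cs.axisRoot_nested hn hκ hM E le_rfl h4) h3
  -- Adjacent walls are nested in neither direction, so their images are adjacent; `htwo` excludes a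
  -- step upwards.
  have hone : ∀ i, i + 2 < L → b i = b (i + 1) + 1 := by
    intro i hi
    have hne : b i ≠ b (i + 1) := by
      intro heq
      have h3 := hb i (by omega)
      rw [heq, ← hb (i + 1) (by omega), neg_inj] at h3
      have := cs.axisRoot_injective hn E ((cs.geomRep g).injective h3)
      omega
    have hup : ∀ i, i + 1 < L → b (i + 1) < b i + 2 := by
      intro i hi
      by_contra hge
      have h3 := cs.axisRoot_nonneg hn E (le_refl (i + 1))
      have h4 := cs.axisRoot_nonpos hn E (Nat.lt_succ_self i)
      have h5 := cs.axisRoot_nested hn hκ hM E (not_lt.1 hge)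
        (g := g * cs.prefixProd E (i + 1)) (by
          rw [hact _ (i + 1) hi, inv_mul_cancel_left, neg_nonpos]
          exact h3)
      rw [hact _ i (by omega), inv_mul_cancel_left, neg_nonpos] at h5
      exact (hroot _ _).not_nonneg.2 h4 h5
    have hdown : ∀ i, i + 1 < L → b i < b (i + 1) + 2 := by
      intro i hi
      by_contra hge
      obtain ⟨x, hx1, hx2⟩ := cs.exists_not_nested_succ hn E i
      have h5 := cs.axisRoot_nested hn hκ hM E (not_lt.1 hge) (g := g * x) (by
          rw [hact _ i (by omega), inv_mul_cancel_left, neg_nonpos]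
          exact hx2)
      rw [hact _ (i + 1) (by omega), inv_mul_cancel_left, neg_nonpos] at h5
      exact (hroot _ _).not_nonneg.2 hx1 h5
    have := hup i (by omega)
    have := hdown i (by omega)
    have : b (i + 1) < b (i + 2) + 2 := hdown (i + 1) (by omega)
    have := htwo i hi
    omega
  have hbk : ∀ k ≤ n, b 0 = b k + k := by
    intro k hk
    induction k with
    | zero => rfl
    | succ k ih =>
      have := ih (by omega)
      have := hone k (by omega)
      omega
  -- `u k` compares the translated axis with the reversed one at the `k`-th wall. It takes a simple
  -- root to a simple root, so its action does not depend on `k`. Hence `u 0` permutes the simple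
  -- roots and is trivial.
  obtain ⟨u, hu⟩ : ∃ u : ℕ → W, ∀ k, u k = (cs.prefixProd E (b k))⁻¹ * g *
      cs.prefixProd E (k + 1) := ⟨_, fun _ => rfl⟩
  have husimple : ∀ k < L, cs.geomRep (u k) (Pi.single (E k) 1) = Pi.single (E (b k)) 1 := by
    intro k hk
    rw [hu, prefixProd, ← mul_assoc, geomRep_mul_apply, geomRep_simple_self, map_neg,
      geomRep_mul_apply, ← axisRoot, geomRep_mul_apply, ← map_neg, hb k hk,
      geomRep_prefixProd_inv_axisRoot]
  have huconst : ∀ k ≤ n, ∀ v, cs.geomRep (u k) v = cs.geomRep (u 0) v := by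
    intro k hk
    induction k with
    | zero => exact fun _ => rfl
    | succ k ih =>
      have hstep : u k = cs.simple (E (b (k + 1))) * u (k + 1) * cs.simple (E (k + 1)) := by
        have h3 := cs.prefixProd_inv_eq E (b (k + 1))
        rw [← hone k (by omega)] at h3
        have h5 : cs.prefixProd E (k + 1 + 1) =
            cs.prefixProd E (k + 1) * cs.simple (E (k + 1)) := by
          rw [prefixProd, Nat.cast_add, Nat.cast_one]
        rw [hu, hu, h3, h5]
        simp [mul_assoc]
      intro v
      have h4 := husimple (k + 1) (by omega)
      push_cast at h4
      rw [← cs.geomRep_conj_of_single_eq h4 v, ← hstep, ih (by omega)]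
  have h0simple : ∀ k < n, cs.geomRep (u 0) (Pi.single (E k) 1) = Pi.single (E (b k)) 1 := by
    intro k hk
    rw [← huconst k hk.le, husimple k (by omega)]
  have hu0 : u 0 = 1 := by
    refine cs.eq_one_of_geomRep_single_nonneg fun i => ?_
    have h3 := h0simple (E.symm i).val (ZMod.val_lt _)
    rw [ZMod.natCast_zmod_val, Equiv.apply_symm_apply] at h3
    rw [h3, Pi.single_nonneg]
    exact zero_le_one
  have hletter : ∀ k < n, ((k : ℕ) : ZMod n) = (b k : ℕ) := by
    intro k hk
    have h3 := h0simple k hk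
    rw [hu0, geomRep_one_apply] at h3
    by_contra hne
    have h4 := congrFun h3 (E k)
    rw [Pi.single_eq_same, Pi.single_eq_of_ne (fun h => hne (E.injective h))] at h4
    exact one_ne_zero h4
  -- The letters agree, so `k ≡ b k` modulo `n`, while `b` decreases as `k` increases: `2 ≡ 0`
  -- modulo `n`, against `n ≥ 3`.
  have e0 := hletter 0 (by omega)
  have e1 := hletter 1 (by omega)
  rw [hone 0 (by omega)] at e0
  push_cast at e0 e1
  rw [← e1] at e0
  have h3 : ((2 : ℕ) : ZMod n) = 0 := by
    push_cast
    rw [e0]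
    norm_num
  rw [ZMod.natCast_eq_zero_iff] at h3
  exact absurd (Nat.le_of_dvd (by norm_num) h3) (by omega)

/-- The half-space of chambers on the negative side of a root. -/
def halfSpace (β : B → ℝ) : Set W := {g | cs.geomRep g⁻¹ β ≤ 0}

theorem mem_halfSpace {β : B → ℝ} {g : W} : g ∈ cs.halfSpace β ↔ cs.geomRep g⁻¹ β ≤ 0 := Iff.rfl

theorem inv_mul_mem_halfSpace {β : B → ℝ} {g x : W} :
    g⁻¹ * x ∈ cs.halfSpace β ↔ cs.geomRep x⁻¹ (cs.geomRep g β) ≤ 0 := by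
  rw [mem_halfSpace, mul_inv_rev, inv_inv, geomRep_mul_apply]

/-- The initial walls of the members separate `x` from `y`, and finitely many walls do. They are
distinct: if `g` and `g'` shared theirs, the chamber just behind it would have to lie beyond wall 2
of `g`. -/
theorem isChain_length_le (hn : 3 ≤ n) (E : ZMod n ≃ B) {L : ℕ} (hL : 3 ≤ L) (x y : W) :
    ∃ C, ∀ l : List W, CountingPattern.IsChain (fun k : Fin L => cs.halfSpace (cs.axisRoot E k))
      {x} {y} l → l.length ≤ C := by
  classical
  refine ⟨(cs.finite_separating x y).toFinset.card, fun l hl => ?_⟩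
  let f : W → B → ℝ := fun g => cs.geomRep g (cs.axisRoot E 0)
  have hnd : (l.map f).Nodup := by
    rw [List.Nodup, List.pairwise_map]
    refine hl.1.imp ?_
    intro g g' hgg' heq
    have h1 := hgg' ⟨2, by omega⟩ ⟨0, by omega⟩ (g * cs.prefixProd E 1) (by
      rw [inv_mul_mem_halfSpace]
      change cs.geomRep _ (f g') ≤ 0
      rw [← heq, mul_inv_rev, geomRep_mul_apply, geomRep_inv_apply_self]
      exact cs.axisRoot_nonpos hn E (by omega))
    rw [inv_mul_cancel_left, mem_halfSpace] at h1
    exact ((cs.isRoot_axisRoot E 2).geomRep _).not_nonneg.2 h1 (cs.axisRoot_nonneg hn E (by omega))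
  rw [← List.length_map (f := f), ← List.toFinset_card_of_nodup hnd]
  refine Finset.card_le_card fun β hβ => ?_
  rw [List.mem_toFinset, List.mem_map] at hβ
  obtain ⟨g, hg, rfl⟩ := hβ
  have h1 := hl.2 g hg ⟨0, by omega⟩
  simp only [Set.mem_singleton_iff, forall_eq, inv_mul_mem_halfSpace] at h1
  have hr : cs.IsRoot (f g) := (cs.isRoot_axisRoot E 0).geomRep g
  rw [Set.Finite.mem_toFinset]
  exact ⟨hr, (hr.geomRep _).not_nonpos.1 h1.1, h1.2⟩

theorem exists_factorization_bound (hn : 3 ≤ n) {κ : ℝ} (hκ : 3 ≤ κ * (n - 1))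
    (hM : ∀ i j, i ≠ j → κ ≤ 2 * M.cosine i j) (E : ZMod n ≃ B) :
    ∃ N > 0, ∀ (k : ℕ) (ts : List W), (∀ t ∈ ts, t * t = 1) →
      ts.prod = cs.prefixProd E n ^ k → k / N ≤ 9 * ts.length := by
  obtain ⟨L, hL⟩ : ∃ L, L = n * (32 * n + 3) + 1 := ⟨_, rfl⟩
  have hLn : n + 2 ≤ L := by rw [hL]; nlinarith
  have hneL : Nonempty (Fin L) := ⟨⟨0, by omega⟩⟩
  refine ⟨L, by omega, fun k ts hts hprod => ?_⟩
  refine CountingPattern.exponent_le_of_prod_eq_pow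
    (P := fun k : Fin L => cs.halfSpace (cs.axisRoot E k))
    (cs.isChain_length_le hn E (by omega)) ?_ (by omega) ?_ ?_ ?_ ?_ hts hprod
  · intro g
    by_contra hc
    push Not at hc
    have hγ : cs.IsRoot (cs.geomRep g (cs.axisRoot E 0)) := (cs.isRoot_axisRoot E 0).geomRep g
    refine cs.not_forall_abs_cosForm_lt_one hn hκ hM E (L := L) (by omega) hγ fun k hk => ?_
    obtain ⟨⟨x, hx1, hx2⟩, ⟨y, hy1, hy2⟩, ⟨z, hz1, hz2⟩, ⟨p, hp1, hp2⟩⟩ :=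
      hc ⟨k, hk⟩ ⟨0, by omega⟩
    have hk := cs.isRoot_axisRoot E k
    rw [inv_mul_mem_halfSpace] at hx2 hy2 hz2 hp2
    rw [mem_halfSpace] at hx1 hy1 hz1 hp1
    rw [(hk.geomRep _).not_nonpos] at hx1 hz1
    rw [(hγ.geomRep _).not_nonpos] at hx2 hy2
    rw [abs_lt]
    constructor
    · by_contra hle
      exact cs.not_separating_of_cosForm_le hγ hk (not_lt.1 hle) hx2 hx1 hp2 hp1
    · by_contra hle
      refine cs.not_separating_of_cosForm_le hγ hk.neg ?_ hy2 (y := z) ?_ hz2 ?_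
      · rw [map_neg]
        linarith
      · rw [map_neg, neg_nonneg]
        exact hy1
      · rw [map_neg, neg_nonpos]
        exact hz1
  · intro k hk i j x hx
    rw [inv_mul_mem_halfSpace, geomRep_pow_axisRoot] at hx
    rw [inv_one, one_mul, mem_halfSpace]
    -- Translation by `w ^ k` with `k ≥ L` moves wall `j` to position `k * n + j`, at least two
    -- beyond any wall `i < L`.
    refine cs.axisRoot_nested hn hκ hM E ?_ hx
    have := i.2
    nlinarith
  · intro k i hmem
    rw [mem_halfSpace, inv_inv, geomRep_pow_axisRoot] at hmem
    refine (cs.isRoot_axisRoot E _).not_nonneg.2 hmem ?_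
    simpa [prefixProd] using cs.axisRoot_nonneg hn E (Nat.zero_le (k * n + i))
  · intro k i hk
    rw [mem_halfSpace, ← prefixProd_period_pow]
    refine cs.axisRoot_nonpos hn E ?_
    have := i.2
    nlinarith
  · intro k g
    by_contra hc
    push Not at hc
    refine cs.not_axis_reversed hn hκ hM E hLn (k * n) g (fun i hi => ?_) fun i hi => ?_
    · have := (hc ⟨i, hi⟩).2
      rwa [mem_halfSpace, inv_inv] at this
    · have := (hc ⟨i, hi⟩).1
      rw [mem_halfSpace, ((cs.isRoot_axisRoot E i).geomRep _).not_nonpos, mul_inv_rev,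
        inv_inv, ← prefixProd_period_pow] at this
      exact this

end CoxeterSystem

/-! ### Reduction to finite labels -/

namespace CoxeterMatrix

variable {B : Type*}

/-- The Coxeter matrix in which all infinite labels are replaced by `5`. -/
def finiteLabels (M : CoxeterMatrix B) : CoxeterMatrix B where
  M := Matrix.of fun i j => if M i j = 0 then 5 else M i j
  isSymm := by
    ext i j
    simp [M.symmetric i j]
  diagonal i := by simp
  off_diagonal i j h := by
    simp only [Matrix.of_apply]
    split_ifs
    · norm_num
    · exact M.off_diagonal i j h

theorem finiteLabels_apply (M : CoxeterMatrix B) (i j : B) :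
    M.finiteLabels i j = if M i j = 0 then 5 else M i j := rfl

/-- The replacement value 5 meets both lower bounds on labels, 5 in rank three and 3 in higher rank.
-/
theorem le_finiteLabels (M : CoxeterMatrix B) {k : ℕ} (hk : k ≤ 5) {i j : B}
    (h : (k : ℕ∞) ≤ M.label i j) : k ≤ M.finiteLabels i j := by
  rw [finiteLabels_apply]
  rw [label] at h
  split_ifs with h0
  · exact hk
  · rw [if_neg h0] at h
    exact_mod_cast h

end CoxeterMatrix

namespace CoxeterSystem

variable {B W : Type*} [Group W] {M : CoxeterMatrix B} (cs : CoxeterSystem M W)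

/-- The canonical surjection onto the Coxeter group with finite labels. -/
noncomputable def toFiniteLabels : W →* M.finiteLabels.Group :=
  cs.lift ⟨M.finiteLabels.toCoxeterSystem.simple, fun i j => by
    rcases eq_or_ne (M i j) 0 with h | h
    · rw [h, pow_zero]
    · have := M.finiteLabels.toCoxeterSystem.simple_mul_simple_pow i j
      rwa [M.finiteLabels_apply, if_neg h] at this⟩

theorem toFiniteLabels_simple (i : B) :
    cs.toFiniteLabels (cs.simple i) = M.finiteLabels.toCoxeterSystem.simple i :=
  cs.lift_apply_simple _ i

theorem exists_equiv_of_nodup (l : List B) (hl : l.Nodup) (hmem : ∀ i, i ∈ l) (hne : l ≠ []) :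
    ∃ E : ZMod l.length ≃ B, (l.map cs.simple).prod = cs.prefixProd E l.length := by
  have : NeZero l.length := ⟨(List.length_pos_iff.2 hne).ne'⟩
  have hbij : Function.Bijective fun x : ZMod l.length => l[x.val]'(ZMod.val_lt x) := by
    constructor
    · intro x y hxy
      exact ZMod.val_injective _ (hl.getElem_inj_iff.1 hxy)
    · intro b
      obtain ⟨k, hk, rfl⟩ := List.mem_iff_getElem.1 (hmem b)
      exact ⟨k, by simp only [ZMod.val_cast_of_lt hk]⟩
  let E : ZMod l.length ≃ B := Equiv.ofBijective _ hbij
  have hE : ∀ k (hk : k < l.length), E (k : ZMod l.length) = l[k] := by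
    intro k hk
    simp only [E, Equiv.ofBijective_apply, ZMod.val_cast_of_lt hk]
  refine ⟨E, ?_⟩
  have key : ∀ k ≤ l.length, cs.prefixProd E k = ((l.take k).map cs.simple).prod := by
    intro k hk
    induction k with
    | zero => simp [prefixProd]
    | succ k ih =>
      rw [prefixProd, ih (by omega), hE k (by omega), List.take_succ_eq_append_getElem (by omega),
        List.map_append, List.prod_append, List.map_singleton, List.prod_singleton]
  rw [key _ le_rfl, List.take_length]

end CoxeterSystem

theorem mainTheorem1 {B W : Type*} [Fintype B] [Group W] {M : CoxeterMatrix B}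
    (cs : CoxeterSystem M W) (n : ℕ) (hn : Fintype.card B = n)
    (w : W) (hw : cs.IsCoxeterElement w)
    (h : (n = 3 ∧ ∀ i j : B, i ≠ j → 5 ≤ M.label i j) ∨
      (4 ≤ n ∧ ∀ i j : B, i ≠ j → 3 ≤ M.label i j)) :
    Filter.Tendsto (fun k : ℕ => cs.reflectionLength (w ^ k)) Filter.atTop Filter.atTop := by
  classical
  obtain ⟨l, hnd, hmem, rfl⟩ := hw
  have hlen : l.length = n := by
    rw [← hn, ← List.toFinset_card_of_nodup hnd, ← Finset.card_univ]
    congr 1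
    ext i
    simp [hmem i]
  have hn3 : 3 ≤ n := by omega
  have hlarge : ∀ i j : B, i ≠ j → 3 ≤ M.finiteLabels i j := by
    intro i j hij
    apply M.le_finiteLabels (by norm_num)
    rcases h with ⟨-, h⟩ | ⟨-, h⟩
    · exact le_trans (by norm_num) (h i j hij)
    · exact h i j hij
  have : M.finiteLabels.IsLarge := ⟨hlarge⟩
  obtain ⟨κ, hκ, hM⟩ : ∃ κ : ℝ, 3 ≤ κ * (l.length - 1) ∧
      ∀ i j : B, i ≠ j → κ ≤ 2 * M.finiteLabels.cosine i j := by
    rw [hlen]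
    -- In rank three, `2 cos (π / 5) = (1 + √5) / 2 ≥ 3/2`; in higher rank, `2 cos (π / 3) = 1` and
    -- `n - 1 ≥ 3`.
    rcases h with ⟨rfl, h⟩ | ⟨h4, -⟩
    · refine ⟨3 / 2, by norm_num, fun i j hij => ?_⟩
      have h1 := M.finiteLabels.cos_pi_div_le_cosine (k := 5) (by norm_num)
        (M.le_finiteLabels le_rfl (h i j hij))
      have h2 : (2 : ℝ) ≤ √5 := Real.le_sqrt_of_sq_le (by norm_num)
      rw [Nat.cast_ofNat, Real.cos_pi_div_five] at h1
      linarith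
    · refine ⟨1, ?_, fun i j hij => ?_⟩
      · have : (4 : ℝ) ≤ n := by exact_mod_cast h4
        linarith
      · have := M.finiteLabels.half_le_cosine hij
        linarith
  obtain ⟨E, hE⟩ := M.finiteLabels.toCoxeterSystem.exists_equiv_of_nodup l hnd hmem (by
    rintro rfl
    simp at hlen
    omega)
  obtain ⟨N, hN, hbound⟩ := M.finiteLabels.toCoxeterSystem.exists_factorization_bound
    (by omega) hκ hM E
  rw [Filter.tendsto_atTop]
  intro b
  filter_upwards [Filter.eventually_ge_atTop (9 * b * N)] with k hk
  obtain ⟨ts, hts, hl, hprod⟩ := cs.exists_reflection_factorization ((l.map cs.simple).prod ^ k)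
  -- A reflection factorization maps to a factorization into involutions of the same length.
  have h1 := hbound k (ts.map cs.toFiniteLabels) (by
    intro t ht
    obtain ⟨r, hr, rfl⟩ := List.mem_map.1 ht
    rw [← map_mul, (hts r hr).mul_self, map_one]) (by
    rw [← map_list_prod, hprod, map_pow, map_list_prod, List.map_map, ← hE]
    congr 3
    ext i
    exact cs.toFiniteLabels_simple i)
  have h2 := (Nat.le_div_iff_mul_le hN).2 hk
  rw [List.length_map, hl] at h1
  omega
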